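/- Let $\mathbb D$ be an infinite set of data values. A data word over a finite alphabet $\mathbb A$ is a nonempty finite word over $\mathbb A\times\mathbb D$; a position $i$ of it has type $\rhd$ if $i+1$ is a position and type $\bar\rhd$ otherwise. An automaton $\mathcal A=\langle\mathbb A,Q,q_I,\delta\rangle$ of the class $\mathsf{ARA}(\mathsf{guess},\mathsf{spread})$ consists of a finite alphabet $\mathbb A$, a finite set $Q$ of states, an initial state $q_I\in Q$, and a map $\delta$ from $Q$ to instructions of the forms $$a\mid\bar a\mid\rhd?\mid\bar\rhd?\mid\mathsf{store}(q)\mid\mathsf{eq}\mid\overline{\mathsf{eq}}\mid q\wedge q'\mid q\vee q'\mid\rhd q\mid\mathsf{guess}(q)\mid\mathsf{spread}(q,q')\qquad(a\in\mathbb A,\ q,q'\in Q).$$ A configuration is a tuple $\langle i,\alpha,(a,d),\Delta\rangle$ of a position $i$, a type $\alpha\in\{\rhd,\bar\rhd\}$, a letter $a\in\mathbb A$, a datum $d\in\mathbb D$, and a finite set $\Delta\subseteq Q\times\mathbb D$ of threads (state, register value). The relation $\rightarrowtail$ on configurations has the following transitions. (1) From $\langle i,\alpha,(a,d),\{(q,d')\}\cup\Delta\rangle$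 to $\langle i,\alpha,(a,d),\Delta'\rangle$, where $\Delta'$ is - $\{(q_j,d')\}\cup\Delta$ with $j\in\{1,2\}$, if $\delta(q)=q_1\vee q_2$; - $\{(q_1,d'),(q_2,d')\}\cup\Delta$, if $\delta(q)=q_1\wedge q_2$; - $\{(q',d)\}\cup\Delta$, if $\delta(q)=\mathsf{store}(q')$; - $\{(q',e)\}\cup\Delta$ for any $e\in\mathbb D$, if $\delta(q)=\mathsf{guess}(q')$; - $\Delta$, if $\delta(q)$ is a test that succeeds, that is, $\mathsf{eq}$ with $d=d'$, or $\overline{\mathsf{eq}}$ with $d\ne d'$, or $\beta?$ with $\beta=\alpha$, or $b$ with $b=a$, or $\bar b$ with $b\ne a$; - $\{(q_1,e)\mid(q_2,e)\in\Delta\}\cup\Delta$, if $\delta(q)=\mathsf{spread}(q_2,q_1)$ and for every $(\tilde q,\tilde d)\in\Delta$ the instruction $\delta(\tilde q)$ is a $\mathsf{spread}$ or of the form $\rhd q'$. (2) From $\langle i,\rhd,\gamma,\Delta\rangle$ to $\langle i+1,\alpha',\gamma',\{(q',e)\mid(q,e)\in\Delta,\ \delta(q)=\rhd q'\}\rangle$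 for any $\alpha'\in\{\rhd,\bar\rhd\}$ and $\gamma'\in\mathbb A\times\mathbb D$, if $\delta(q)$ has the form $\rhd q'$ for every $(q,e)\in\Delta$. A run of $\mathcal A$ over a data word $w$ is a nonempty finite sequence $\mathcal C_1\rightarrowtail\dots\rightarrowtail\mathcal C_n$ of configurations, each of the form $\langle i,\alpha,w(i),\Delta\rangle$ with $i$ a position of $w$ and $\alpha$ its type, such that $\mathcal C_1$ is at the first position and its only thread is $(q_I,d_1)$, where $d_1$ is the first datum of $w$. The run is accepting if the set of threads of $\mathcal C_n$ is empty; a configuration with no threads is called accepting. $L(\mathcal A)$ is the set of data words that have an accepting run. For configurations, $\rho\sim\rho'$ means that some bijection between the data values occurring in $\rho$ and those occurring in $\rho'$ transforms $\rho$ into $\rho'$; $\langle i,\alpha,\gamma,\Delta\rangle\preceq\langle i',\alpha',\gamma',\Delta'\rangle$ means $\alpha=\alpha'$, $\gamma=\gamma'$ and $\Delta\subseteq\Delta'$; and $\rho\precsim\rho'$ means that $\rho\preceq\rho''$ for some $\rho''\sim\rho'$. **Theorem.** The emptiness problem for $\mathsf{ARA}(\mathsf{guess},\mathsf{spread})$,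 that is, given (a finite description of) an automaton $\mathcal A$ of this class, to decide whether $L(\mathcal A)=\emptyset$, is decidable. Moreover, for every such $\mathcal A$: - $\precsim$ is a well-quasi-order on the set of configurations; - $\rightarrowtail$ is reflexive downward compatible with $\precsim$: if $\rho'\precsim\rho$ and $\rho\rightarrowtail\tau$, then there is $\tau'\precsim\tau$ with $\rho'\rightarrowtail\tau'$ or $\tau'=\rho'$; - the set of accepting configurations is downward closed with respect to $\precsim$. -/

import Mathlib

universe u v w

/-- The type of a position of a word: `hasNext` (written `▷`) if there is a next position,
`isLast` (written `▷` with a bar) if there is none. -/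
inductive WordType where
  | hasNext
  | isLast

/-- The instructions `Φ` of an alternating one-register automaton with `guess` and `spread`,
over the alphabet `A` and the states `Q`. -/
inductive Instr (A : Type v) (Q : Type w) where
  | letter (a : A)
  | notLetter (a : A)
  | test (β : WordType)
  | store (q : Q)
  | eq
  | neq
  | and (q₁ q₂ : Q)
  | or (q₁ q₂ : Q)
  | move (q : Q)
  | guess (q : Q)
  | spread (q₂ q₁ : Q)

/-- An automaton of `ARA(guess, spread)` with alphabet `A` and set of states `Q`
(both are taken finite wherever automata are quantified over). -/
structure ARA (A : Type v) (Q : Type w) where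
  start : Q
  δ : Q → Instr A Q

namespace Instr

variable {A : Type v} {Q : Type w}

def IsMoving (φ : Instr A Q) : Prop := ∃ q, φ = move q

def IsSpread (φ : Instr A Q) : Prop := ∃ q₂ q₁, φ = spread q₂ q₁

/-- An instruction written as a tag with two arguments, given numberings of `A` and `Q`. -/
def code {k n : ℕ} (eA : A ≃ Fin k) (eQ : Q ≃ Fin n) : Instr A Q → ℕ × ℕ × ℕ
  | letter a => (0, eA a, 0)
  | notLetter a => (1, eA a, 0)
  | test .hasNext => (2, 0, 0)
  | test .isLast => (2, 1, 0)
  | store q => (3, eQ q, 0)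
  | eq => (4, 0, 0)
  | neq => (5, 0, 0)
  | and q₁ q₂ => (6, eQ q₁, eQ q₂)
  | or q₁ q₂ => (7, eQ q₁, eQ q₂)
  | move q => (8, eQ q, 0)
  | guess q => (9, eQ q, 0)
  | spread q₂ q₁ => (10, eQ q₂, eQ q₁)

theorem code_injective {k n : ℕ} (eA : A ≃ Fin k) (eQ : Q ≃ Fin n) :
    Function.Injective (code eA eQ) := by
  intro φ ψ h
  rcases φ with _ | _ | ⟨_ | _⟩ | _ | _ | _ | _ | _ | _ | _ | _ <;>
    rcases ψ with _ | _ | ⟨_ | _⟩ | _ | _ | _ | _ | _ | _ | _ | _ <;>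
    simp_all [code, Fin.val_inj]

end Instr

/-- A configuration `⟨i, α, γ, Δ⟩`: position, word type, letter and datum of the position, and
finite set of threads (state, register value). Positions are numbered from `0`. -/
@[ext]
structure Config (A : Type v) (Q : Type w) (D : Type u) where
  pos : ℕ
  type : WordType
  label : A × D
  threads : Finset (Q × D)

namespace Config

variable {A : Type v} {Q : Type w} {D : Type u}

/-- The configuration describes a position of the data word `x`, with its type and label. -/
def Fits (x : List (A × D)) (C : Config A Q D) : Prop :=
  x[C.pos]? = some C.label ∧ (C.type = .hasNext ↔ C.pos + 1 < x.length)

def Accepting (C : Config A Q D) : Prop := C.threads = ∅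

/-- The data values that occur in a configuration. -/
def data (C : Config A Q D) : Set D :=
  {e | e = C.label.2 ∨ ∃ q, (q, e) ∈ C.threads}

/-- The replacement of every data value `e` by `f e`. -/
def rename [DecidableEq Q] [DecidableEq D] (f : D → D) (C : Config A Q D) : Config A Q D :=
  ⟨C.pos, C.type, (C.label.1, f C.label.2), C.threads.image fun t => (t.1, f t.2)⟩

/-- `ρ ∼ ρ'`: some bijection `data ρ → data ρ'` turns `ρ` into `ρ'`. -/
def Equiv [DecidableEq Q] [DecidableEq D] (ρ ρ' : Config A Q D) : Prop :=
  ∃ f : D → D, Set.BijOn f ρ.data ρ'.data ∧ ρ.rename f = ρ'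

/-- `ρ ⪯ ρ'`: inclusion of threads; the position is ignored. -/
def Incl (ρ ρ' : Config A Q D) : Prop :=
  ρ.type = ρ'.type ∧ ρ.label = ρ'.label ∧ ρ.threads ⊆ ρ'.threads

/-- `ρ ≾ ρ'`: inclusion of threads modulo renaming of data values. -/
def Below [DecidableEq Q] [DecidableEq D] (ρ ρ' : Config A Q D) : Prop :=
  ∃ ρ'', ρ''.Equiv ρ' ∧ ρ.Incl ρ''

end Config

namespace ARA

variable {A : Type v} {Q : Type w} {D : Type u} [DecidableEq Q] [DecidableEq D]

/-- The non-moving transitions. As `Δ` is arbitrary, `insert t Δ` is any set of threads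
that contains `t`. -/
inductive StepEps (M : ARA A Q) : Config A Q D → Config A Q D → Prop
  | or_left {i α γ q e Δ q₁ q₂} (h : M.δ q = .or q₁ q₂) :
      StepEps M ⟨i, α, γ, insert (q, e) Δ⟩ ⟨i, α, γ, insert (q₁, e) Δ⟩
  | or_right {i α γ q e Δ q₁ q₂} (h : M.δ q = .or q₁ q₂) :
      StepEps M ⟨i, α, γ, insert (q, e) Δ⟩ ⟨i, α, γ, insert (q₂, e) Δ⟩
  | and {i α γ q e Δ q₁ q₂} (h : M.δ q = .and q₁ q₂) :
      StepEps M ⟨i, α, γ, insert (q, e) Δ⟩ ⟨i, α, γ, {(q₁, e), (q₂, e)} ∪ Δ⟩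
  | store {i α a d q e Δ q'} (h : M.δ q = .store q') :
      StepEps M ⟨i, α, (a, d), insert (q, e) Δ⟩ ⟨i, α, (a, d), insert (q', d) Δ⟩
  | eq {i α a d q e Δ} (h : M.δ q = .eq) (hd : d = e) :
      StepEps M ⟨i, α, (a, d), insert (q, e) Δ⟩ ⟨i, α, (a, d), Δ⟩
  | neq {i α a d q e Δ} (h : M.δ q = .neq) (hd : d ≠ e) :
      StepEps M ⟨i, α, (a, d), insert (q, e) Δ⟩ ⟨i, α, (a, d), Δ⟩
  | test {i α γ q e Δ β} (h : M.δ q = .test β) (hβ : β = α) :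
      StepEps M ⟨i, α, γ, insert (q, e) Δ⟩ ⟨i, α, γ, Δ⟩
  | letter {i α a d q e Δ b} (h : M.δ q = .letter b) (hb : b = a) :
      StepEps M ⟨i, α, (a, d), insert (q, e) Δ⟩ ⟨i, α, (a, d), Δ⟩
  | notLetter {i α a d q e Δ b} (h : M.δ q = .notLetter b) (hb : b ≠ a) :
      StepEps M ⟨i, α, (a, d), insert (q, e) Δ⟩ ⟨i, α, (a, d), Δ⟩
  | guess {i α γ q e Δ q'} (h : M.δ q = .guess q') (e' : D) :
      StepEps M ⟨i, α, γ, insert (q, e) Δ⟩ ⟨i, α, γ, insert (q', e') Δ⟩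
  | spread {i α γ q e Δ q₂ q₁} (h : M.δ q = .spread q₂ q₁)
      (hΔ : ∀ t ∈ Δ, (M.δ t.1).IsSpread ∨ (M.δ t.1).IsMoving) :
      StepEps M ⟨i, α, γ, insert (q, e) Δ⟩
        ⟨i, α, γ, (Δ.filter fun t => t.1 = q₂).image (fun t => (q₁, t.2)) ∪ Δ⟩

/-- The moving transitions: all threads advance simultaneously to a next position with an
arbitrary type and label. -/
inductive StepMove (M : ARA A Q) : Config A Q D → Config A Q D → Prop
  | mk {i γ Δ α' γ' Δ'} (hmov : ∀ t ∈ Δ, (M.δ t.1).IsMoving)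
      (hΔ : ∀ t : Q × D, t ∈ Δ' ↔ ∃ q, (q, t.2) ∈ Δ ∧ M.δ q = .move t.1) :
      StepMove M ⟨i, .hasNext, γ, Δ⟩ ⟨i + 1, α', γ', Δ'⟩

/-- The transition relation between configurations. -/
def Step (M : ARA A Q) (C C' : Config A Q D) : Prop :=
  M.StepMove C C' ∨ M.StepEps C C'

/-- The nonempty sequence `r` of configurations is a run of `M` over the data word `x`. -/
def IsRun (M : ARA A Q) (x : List (A × D)) (r : List (Config A Q D)) : Prop :=
  (∃ α γ, r.head? = some ⟨0, α, γ, {(M.start, γ.2)}⟩) ∧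
    r.IsChain M.Step ∧ ∀ C ∈ r, C.Fits x

/-- The set of data words with an accepting run. Data words are nonempty; the list `[]` has
no run because no configuration fits it. -/
def language (M : ARA A Q) (D : Type u) [DecidableEq D] : Set (List (A × D)) :=
  {x | ∃ r, M.IsRun x r ∧ ∃ C, r.getLast? = some C ∧ C.Accepting}

end ARA

namespace ARA

variable {A : Type v} {Q : Type w}

/-- The finite description of an automaton that is the input of the emptiness problem, given
numberings of the alphabet and the states: the size of the alphabet, the number of the initial
state, and the table of `δ`. -/
def code (M : ARA A Q) {k n : ℕ} (eA : A ≃ Fin k) (eQ : Q ≃ Fin n) :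
    ℕ × ℕ × List (ℕ × ℕ × ℕ) :=
  (k, eQ M.start, List.ofFn fun j : Fin n => (M.δ (eQ.symm j)).code eA eQ)

theorem code_injective {k n : ℕ} (eA : A ≃ Fin k) (eQ : Q ≃ Fin n) :
    Function.Injective fun M : ARA A Q => M.code eA eQ := by
  rintro ⟨s, δ⟩ ⟨s', δ'⟩ h
  simp only [code, Prod.mk.injEq, true_and, Fin.val_inj, EmbeddingLike.apply_eq_iff_eq] at h
  obtain ⟨rfl, h⟩ := h
  have h2 := List.ofFn_injective h
  congr 1
  funext q
  simpa using Instr.code_injective eA eQ (congrFun h2 (eQ q))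

end ARA

/-- `r` is a well-quasi-order. -/
def IsWQO {S : Type*} (r : S → S → Prop) : Prop :=
  (∀ a, r a a) ∧ (∀ a b c, r a b → r b c → r a c) ∧ WellQuasiOrdered r

/-- The transition system `step` is reflexive downward compatible with respect to `r`. -/
def IsRDC {S : Type*} (step r : S → S → Prop) : Prop :=
  ∀ a₁ a₂ a₁', r a₁' a₁ → step a₁ a₂ → ∃ a₂', r a₂' a₂ ∧ (step a₁' a₂' ∨ a₁' = a₂')

/-- The set `V` is downward closed with respect to `r`. -/
def IsDownwardClosed {S : Type*} (r : S → S → Prop) (V : Set S) : Prop :=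
  ∀ a b, b ∈ V → r a b → a ∈ V

/-!
Up to renaming, only the set of data paired with the same states as a given datum matters, so by
Dickson's lemma `Config.Below` is a well-quasi-order. Hence the configurations reachable over `ℕ`
have a finite basis, and since smaller configurations simulate larger ones, the language is empty
iff some finite set of non-accepting configurations contains the initial ones and is closed under
`↣` up to `Config.Below`. A step out of a configuration involves, up to renaming, at most one datum
outside any finite set containing its data, so checking such a closed set is a finite computation
on data below a fixed bound. Nonemptiness is witnessed by a finite run. Both searches range over
primitive recursive predicates, and the answer does not depend on the infinite set of data.
-/

theorem exists_embedding_of_card_fiber_le {α β κ : Type*} [Finite α] [Finite β] {c : α → κ}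
    {c' : β → κ} (h : ∀ k, Nat.card {a // c a = k} ≤ Nat.card {b // c' b = k}) :
    ∃ f : α ↪ β, ∀ a, c' (f a) = c a := by
  have hφ (k : κ) : Nonempty ({a // c a = k} ↪ {b // c' b = k}) := by
    have := Fintype.ofFinite {a // c a = k}
    have := Fintype.ofFinite {b // c' b = k}
    refine Function.Embedding.nonempty_of_card_le ?_
    simpa only [Nat.card_eq_fintype_card] using h k
  obtain ⟨φ⟩ := Classical.nonempty_pi.2 hφ
  exact ⟨(Equiv.sigmaFiberEquiv c).symm.toEmbedding.trans
    ((Function.Embedding.sigmaMap (.refl κ) φ).trans (Equiv.sigmaFiberEquiv c').toEmbedding),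
    fun a => (φ (c a) ⟨a, rfl⟩).2⟩

theorem exists_perm_eqOn_of_injOn {D : Type u} {s : Set D} (hs : s.Finite) {f : D → D}
    (hf : s.InjOn f) : ∃ π : Equiv.Perm D, s.EqOn π f := by
  have := hs.to_subtype
  obtain ⟨π, hπ⟩ := Equiv.Perm.exists_extending_pair (Subtype.val : s → D) (fun x => f x)
    Subtype.val_injective (Set.injOn_iff_injective.1 hf)
  exact ⟨π, fun d hd => hπ ⟨d, hd⟩⟩

theorem exists_finite_basis {α : Type*} {r : α → α → Prop} (hr : WellQuasiOrdered r)
    (s : Set α) : ∃ b ⊆ s, b.Finite ∧ ∀ x ∈ s, ∃ y ∈ b, r y x := by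
  by_contra! h
  obtain ⟨f, -, hrf⟩ := exists_seq_of_forall_finset_exists (· ∈ s) (fun x y => ¬ r x y)
    fun b hb => by
      obtain ⟨x, hx, hbx⟩ := h b hb b.finite_toSet
      exact ⟨x, hx, hbx⟩
  obtain ⟨m, n, hmn, hr⟩ := hr f
  exact hrf m n hmn hr

instance : Finite WordType :=
  Finite.of_injective (fun | .hasNext => true | .isLast => false)
    (by rintro (_ | _) (_ | _) h <;> simp_all)

namespace Config

variable {A : Type v} {Q : Type w} {D : Type u}

theorem label_mem_data (C : Config A Q D) : C.label.2 ∈ C.data := Or.inl rfl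

theorem mem_data_of_mem_threads {C : Config A Q D} {t : Q × D} (ht : t ∈ C.threads) :
    t.2 ∈ C.data := Or.inr ⟨t.1, ht⟩

theorem data_eq (C : Config A Q D) :
    C.data = insert C.label.2 (Prod.snd '' (C.threads : Set (Q × D))) := by
  ext e
  simp [data]

theorem finite_data (C : Config A Q D) : C.data.Finite :=
  C.data_eq ▸ (C.threads.finite_toSet.image _).insert _

theorem Incl.refl (C : Config A Q D) : C.Incl C := ⟨rfl, rfl, Finset.Subset.refl _⟩

theorem Incl.trans {C₁ C₂ C₃ : Config A Q D} (h : C₁.Incl C₂) (h' : C₂.Incl C₃) : C₁.Incl C₃ :=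
  ⟨h.1.trans h'.1, h.2.1.trans h'.2.1, h.2.2.trans h'.2.2⟩

/-- What a configuration says about a data value: whether it is the current datum, and the states
of the threads that store it. -/
def profile (C : Config A Q D) (e : D) : Prop × Set Q :=
  (e = C.label.2, {q | (q, e) ∈ C.threads})

variable [DecidableEq Q] [DecidableEq D]

theorem rename_congr {f g : D → D} {C : Config A Q D} (h : C.data.EqOn f g) :
    C.rename f = C.rename g := by
  have hthreads : C.threads.image (fun t => (t.1, f t.2)) =
      C.threads.image (fun t => (t.1, g t.2)) :=
    Finset.image_congr fun t ht => by
      simp only [h (mem_data_of_mem_threads (Finset.mem_coe.1 ht))]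
  simp only [rename, h C.label_mem_data, hthreads]

@[simp]
theorem rename_id (C : Config A Q D) : C.rename id = C := by
  simp [rename]

theorem rename_rename (f g : D → D) (C : Config A Q D) :
    (C.rename f).rename g = C.rename (g ∘ f) := by
  simp [rename, Finset.image_image, Function.comp_def]

@[simp]
theorem rename_rename_symm (π : Equiv.Perm D) (C : Config A Q D) :
    (C.rename π.symm).rename π = C := by
  simp [rename_rename]

theorem Incl.rename {C C' : Config A Q D} (h : C.Incl C') (f : D → D) :
    (C.rename f).Incl (C'.rename f) :=
  ⟨h.1, by simp only [Config.rename, h.2.1], Finset.image_subset_image h.2.2⟩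

theorem data_rename (f : D → D) (C : Config A Q D) : (C.rename f).data = f '' C.data := by
  simp [data_eq, Config.rename, Set.image_insert_eq, Set.image_image]

theorem below_iff {ρ ρ' : Config A Q D} :
    ρ.Below ρ' ↔ ∃ π : Equiv.Perm D, (ρ.rename π).Incl ρ' := by
  constructor
  · rintro ⟨ρ'', ⟨f, hf, rfl⟩, hρ⟩
    obtain ⟨π, hπ⟩ := exists_perm_eqOn_of_injOn ρ''.finite_data hf.injOn
    exact ⟨π, rename_congr hπ ▸ hρ.rename π⟩
  · rintro ⟨π, h⟩
    refine ⟨ρ'.rename π.symm, ⟨π, ?_, ρ'.rename_rename_symm π⟩, ?_⟩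
    · have hdata : ρ'.data = π '' (ρ'.rename π.symm).data := by
        rw [← data_rename, rename_rename_symm]
      rw [hdata]
      exact π.injective.injOn.bijOn_image
    · simpa [rename_rename] using h.rename π.symm

theorem Incl.below {C C' : Config A Q D} (h : C.Incl C') : C.Below C' :=
  below_iff.2 ⟨Equiv.refl D, by simpa using h⟩

theorem Below.trans {C₁ C₂ C₃ : Config A Q D} (h : C₁.Below C₂) (h' : C₂.Below C₃) :
    C₁.Below C₃ := by
  obtain ⟨π, hπ⟩ := below_iff.1 h
  obtain ⟨π', hπ'⟩ := below_iff.1 h'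
  refine below_iff.2 ⟨π.trans π', ?_⟩
  simpa [rename_rename] using (hπ.rename π').trans hπ'

theorem Below.accepting {C C' : Config A Q D} (h : C.Below C') (h' : C'.Accepting) :
    C.Accepting := by
  obtain ⟨π, -, -, hπ⟩ := below_iff.1 h
  rw [Accepting] at h'
  rwa [h', Finset.subset_empty, rename, Finset.image_eq_empty] at hπ

theorem below_of_card_profile_le {C C' : Config A Q D} (htype : C.type = C'.type)
    (hletter : C.label.1 = C'.label.1)
    (hcard : ∀ p, Nat.card {e : C.data // C.profile e = p} ≤
      Nat.card {e : C'.data // C'.profile e = p}) : C.Below C' := by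
  have := C.finite_data.to_subtype
  have := C'.finite_data.to_subtype
  obtain ⟨f, hf⟩ := exists_embedding_of_card_fiber_le hcard
  obtain ⟨π, hπ⟩ := Equiv.Perm.exists_extending_pair (Subtype.val : C.data → D)
    (fun e => (f e : D)) Subtype.val_injective (Subtype.val_injective.comp f.injective)
  have hprofile {e : D} (he : e ∈ C.data) : C'.profile (π e) = C.profile e :=
    (hπ ⟨e, he⟩).symm ▸ hf ⟨e, he⟩
  refine below_iff.2 ⟨π, htype, Prod.ext hletter ?_, ?_⟩
  · exact (congrArg Prod.fst (hprofile C.label_mem_data)).mpr rfl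
  · intro t ht
    obtain ⟨s, hs, rfl⟩ := Finset.mem_image.1 ht
    exact (Set.ext_iff.1 (congrArg Prod.snd (hprofile (mem_data_of_mem_threads hs))) s.1).2 hs

theorem wellQuasiOrdered_below [Finite A] [Finite Q] :
    WellQuasiOrdered (Below (A := A) (Q := Q) (D := D)) := by
  intro f
  obtain ⟨m, n, hmn, heq, hle⟩ := ((Finite.wellQuasiOrdered (α := WordType × A) (· = ·)).prod
    (wellQuasiOrdered_le (α := Prop × Set Q → ℕ)))
      fun n => (((f n).type, (f n).label.1),
        fun p => Nat.card {e : (f n).data // (f n).profile e = p})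
  exact ⟨m, n, hmn, below_of_card_profile_le (congrArg Prod.fst heq) (congrArg Prod.snd heq) hle⟩

theorem isWQO_below [Finite A] [Finite Q] : IsWQO (Below (A := A) (Q := Q) (D := D)) :=
  ⟨fun C => (Incl.refl C).below, fun _ _ _ => Below.trans, wellQuasiOrdered_below⟩

end Config

namespace Config

variable {A : Type v} {Q : Type w} {D : Type u} {D' : Type*} [DecidableEq Q] [DecidableEq D']

/-- `Config.rename` for maps between two sets of data values. -/
def mapData (f : D → D') (C : Config A Q D) : Config A Q D' :=
  ⟨C.pos, C.type, (C.label.1, f C.label.2), C.threads.image fun t => (t.1, f t.2)⟩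

theorem Accepting.mapData {C : Config A Q D} (h : C.Accepting) (f : D → D') :
    (C.mapData f).Accepting :=
  Finset.image_eq_empty.2 h

end Config

namespace ARA

theorem StepMove.fits {A : Type v} {Q : Type w} {D : Type u} {M : ARA A Q} {C C' : Config A Q D}
    {x : List (A × D)} (h : M.StepMove C C') (hC' : C'.Fits x)
    (hlabel : x[C.pos]? = some C.label) : C.Fits x := by
  obtain ⟨-, -⟩ := h
  obtain ⟨hpos, -⟩ := List.getElem?_eq_some_iff.1 hC'.1
  exact ⟨hlabel, iff_of_true rfl hpos⟩

variable {A : Type v} {Q : Type w} {D : Type u} {D' : Type*} [DecidableEq Q] [DecidableEq D]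
  [DecidableEq D'] {M : ARA A Q} {C C' B : Config A Q D}

/-- `M.Effect α γ Δ t X`: at a position with type `α` and label `γ`, the instruction of the thread
`t` may replace `t` by the threads `X` while the other threads are `Δ`. -/
def Effect (M : ARA A Q) (α : WordType) (γ : A × D) (Δ : Finset (Q × D)) (t : Q × D)
    (X : Finset (Q × D)) : Prop :=
  match M.δ t.1 with
  | .letter b => b = γ.1 ∧ X = ∅
  | .notLetter b => b ≠ γ.1 ∧ X = ∅
  | .test β => β = α ∧ X = ∅
  | .store q => X = {(q, γ.2)}
  | .eq => γ.2 = t.2 ∧ X = ∅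
  | .neq => γ.2 ≠ t.2 ∧ X = ∅
  | .and q₁ q₂ => X = {(q₁, t.2), (q₂, t.2)}
  | .or q₁ q₂ => X = {(q₁, t.2)} ∨ X = {(q₂, t.2)}
  | .move _ => False
  | .guess q => ∃ e, X = {(q, e)}
  | .spread q₂ q₁ => (∀ s ∈ Δ, (M.δ s.1).IsSpread ∨ (M.δ s.1).IsMoving) ∧
      X = (Δ.filter fun s => s.1 = q₂).image fun s => (q₁, s.2)

theorem Effect.mono {α : WordType} {γ : A × D} {Δ Δ' : Finset (Q × D)} {t : Q × D}
    {X : Finset (Q × D)} (h : M.Effect α γ Δ t X) (hΔ : Δ' ⊆ Δ) :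
    ∃ X' ⊆ X, M.Effect α γ Δ' t X' := by
  unfold Effect at h ⊢
  split at h
  case h_11 =>
    obtain ⟨h, rfl⟩ := h
    exact ⟨_, Finset.image_subset_image (Finset.filter_subset_filter _ hΔ),
      fun s hs => h s (hΔ hs), rfl⟩
  all_goals exact ⟨X, Finset.Subset.refl _, h⟩

theorem Effect.mapData {α : WordType} {γ : A × D} {Δ X : Finset (Q × D)} {t : Q × D}
    (h : M.Effect α γ Δ t X) {f : D → D'} (hf : f γ.2 = f t.2 → γ.2 = t.2) :
    M.Effect α (γ.1, f γ.2) (Δ.image fun s => (s.1, f s.2)) (t.1, f t.2)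
      (X.image fun s => (s.1, f s.2)) := by
  unfold Effect at h ⊢
  dsimp only
  split at h
  case h_5 => exact ⟨congrArg f h.1, by simp [h.2]⟩
  case h_6 => exact ⟨mt hf h.1, by simp [h.2]⟩
  case h_8 => exact h.imp (by simp [·]) (by simp [·])
  case h_9 => exact h
  case h_10 => exact h.imp' f fun e h => by simp [h]
  case h_11 =>
    obtain ⟨h, rfl⟩ := h
    refine ⟨Finset.forall_mem_image.2 h, ?_⟩
    simp [Finset.filter_image, Finset.image_image, Function.comp_def]
  all_goals simp [h, Finset.image_insert]

theorem Effect.exists_snd_mem {α : WordType} {γ : A × D} {Δ X : Finset (Q × D)} {t : Q × D}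
    (h : M.Effect α γ Δ t X) :
    ∃ e, ∀ s ∈ X, s.2 = e ∨ s.2 = γ.2 ∨ ∃ q, (q, s.2) ∈ insert t Δ := by
  unfold Effect at h
  split at h
  case h_10 =>
    obtain ⟨e, rfl⟩ := h
    exact ⟨e, by simp⟩
  all_goals refine ⟨t.2, ?_⟩
  case h_8 => obtain rfl | rfl := h <;> simp
  case h_9 => exact h.elim
  case h_11 =>
    obtain ⟨-, rfl⟩ := h
    intro s hs
    obtain ⟨s', hs', rfl⟩ := Finset.mem_image.1 hs
    exact .inr (.inr ⟨s'.1, Finset.mem_insert_of_mem (Finset.mem_filter.1 hs').1⟩)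
  all_goals simp [h]

theorem stepEps_iff : M.StepEps C C' ↔ ∃ t Δ X, C.threads = insert t Δ ∧
    M.Effect C.type C.label Δ t X ∧ C' = ⟨C.pos, C.type, C.label, X ∪ Δ⟩ := by
  constructor
  · intro h
    cases h
    case' or_left e _ q₁ _ h => refine ⟨_, _, {(q₁, e)}, rfl, ?_, rfl⟩
    case' or_right e _ _ q₂ h => refine ⟨_, _, {(q₂, e)}, rfl, ?_, rfl⟩
    case' and h => refine ⟨_, _, _, rfl, ?_, rfl⟩
    case' store d _ _ _ q' h => refine ⟨_, _, {(q', d)}, rfl, ?_, rfl⟩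
    case' guess q' h e' => refine ⟨_, _, {(q', e')}, rfl, ?_, rfl⟩
    case' spread h hΔ => refine ⟨_, _, _, rfl, ?_, rfl⟩
    case' eq h hd => refine ⟨_, _, ∅, rfl, ?_, by rw [Finset.empty_union]⟩
    case' neq h hd => refine ⟨_, _, ∅, rfl, ?_, by rw [Finset.empty_union]⟩
    case' test h hd => refine ⟨_, _, ∅, rfl, ?_, by rw [Finset.empty_union]⟩
    case' letter h hd => refine ⟨_, _, ∅, rfl, ?_, by rw [Finset.empty_union]⟩
    case' notLetter h hd => refine ⟨_, _, ∅, rfl, ?_, by rw [Finset.empty_union]⟩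
    case spread => simpa [Effect, h] using hΔ
    all_goals simp [Effect, *]
  · rintro ⟨⟨q, e⟩, Δ, X, hΔ, h, rfl⟩
    obtain ⟨i, α, ⟨a, d⟩, _⟩ := C
    obtain rfl : _ = insert (q, e) Δ := hΔ
    unfold Effect at h
    split at h
    case h_1 hδ => simpa [h.2] using StepEps.letter hδ h.1
    case h_2 hδ => simpa [h.2] using StepEps.notLetter hδ h.1
    case h_3 hδ => simpa [h.2] using StepEps.test hδ h.1
    case h_4 hδ => simpa [h] using StepEps.store hδ
    case h_5 hδ => simpa [h.2] using StepEps.eq hδ h.1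
    case h_6 hδ => simpa [h.2] using StepEps.neq hδ h.1
    case h_7 hδ => simpa [h] using StepEps.and hδ
    case h_8 hδ =>
      obtain rfl | rfl := h
      · exact StepEps.or_left hδ
      · exact StepEps.or_right hδ
    case h_9 => exact h.elim
    case h_10 hδ =>
      obtain ⟨e', rfl⟩ := h
      exact StepEps.guess hδ e'
    case h_11 hδ => simpa [h.2] using StepEps.spread hδ h.1

/-- The threads after a moving transition. -/
def movedThreads (M : ARA A Q) (Δ : Finset (Q × D)) : Finset (Q × D) :=
  Δ.biUnion fun t => match M.δ t.1 with
    | .move q => {(q, t.2)}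
    | _ => ∅

theorem mem_movedThreads {Δ : Finset (Q × D)} {t : Q × D} :
    t ∈ M.movedThreads Δ ↔ ∃ q, (q, t.2) ∈ Δ ∧ M.δ q = .move t.1 := by
  simp only [movedThreads, Finset.mem_biUnion]
  constructor
  · rintro ⟨s, hs, h⟩
    split at h
    · next q hq =>
      obtain rfl := Finset.mem_singleton.1 h
      exact ⟨s.1, hs, hq⟩
    · simp at h
  · rintro ⟨q, hq, h⟩
    exact ⟨_, hq, by simp [h]⟩

theorem movedThreads_mono {Δ Δ' : Finset (Q × D)} (h : Δ ⊆ Δ') :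
    M.movedThreads Δ ⊆ M.movedThreads Δ' :=
  Finset.biUnion_subset_biUnion_of_subset_left _ h

theorem movedThreads_image (f : D → D') (Δ : Finset (Q × D)) :
    M.movedThreads (Δ.image fun t => (t.1, f t.2)) =
      (M.movedThreads Δ).image fun t => (t.1, f t.2) := by
  simp only [movedThreads, Finset.image_biUnion, Finset.biUnion_image]
  refine Finset.biUnion_congr rfl fun t _ => ?_
  cases M.δ t.1 <;> simp

theorem stepMove_iff : M.StepMove C C' ↔ C.type = .hasNext ∧
    (∀ t ∈ C.threads, (M.δ t.1).IsMoving) ∧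
      ∃ α γ, C' = ⟨C.pos + 1, α, γ, M.movedThreads C.threads⟩ := by
  constructor
  · rintro ⟨hmov, hΔ⟩
    refine ⟨rfl, hmov, _, _, Config.ext rfl rfl rfl ?_⟩
    ext t
    rw [hΔ, mem_movedThreads]
  · rintro ⟨hα, hmov, α, γ, rfl⟩
    obtain ⟨i, _, γ', Δ⟩ := C
    obtain rfl := hα
    exact .mk hmov fun t => mem_movedThreads

theorem Step.exists_of_incl (h : M.Step C C') (hB : B.Incl C) :
    ∃ B', B'.Incl C' ∧ (M.Step B B' ∨ B = B') := by
  obtain ⟨htype, hlabel, hsub⟩ := hB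
  obtain h | h := h
  · obtain ⟨hα, hmov, α, γ, rfl⟩ := stepMove_iff.1 h
    exact ⟨⟨B.pos + 1, α, γ, M.movedThreads B.threads⟩, ⟨rfl, rfl, movedThreads_mono hsub⟩,
      .inl (.inl (stepMove_iff.2 ⟨htype.trans hα, fun t ht => hmov t (hsub ht), α, γ, rfl⟩))⟩
  · obtain ⟨t, Δ, X, hΔ, hX, rfl⟩ := stepEps_iff.1 h
    rw [hΔ] at hsub
    by_cases ht : t ∈ B.threads
    · obtain ⟨X', hX', hE⟩ := hX.mono (Finset.inter_subset_right : B.threads ∩ Δ ⊆ Δ)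
      have hrest : B.threads = insert t (B.threads ∩ Δ) := by grind
      rw [← htype, ← hlabel] at hE
      exact ⟨⟨B.pos, B.type, B.label, X' ∪ B.threads ∩ Δ⟩,
        ⟨htype, hlabel, Finset.union_subset_union hX' Finset.inter_subset_right⟩,
        .inl (.inr (stepEps_iff.2 ⟨t, _, X', hrest, hE, rfl⟩))⟩
    · rw [Finset.subset_insert_iff_of_notMem ht] at hsub
      exact ⟨B, ⟨htype, hlabel, hsub.trans Finset.subset_union_right⟩, .inr rfl⟩

theorem Step.mapData (h : M.Step C C') {f : D → D'} (hf : C.data.InjOn f) :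
    M.Step (C.mapData f) (C'.mapData f) := by
  obtain h | h := h
  · obtain ⟨hα, hmov, α, γ, rfl⟩ := stepMove_iff.1 h
    refine .inl (stepMove_iff.2 ⟨hα, Finset.forall_mem_image.2 hmov, α, (γ.1, f γ.2), ?_⟩)
    simp only [Config.mapData, movedThreads_image]
  · obtain ⟨t, Δ, X, hΔ, hX, rfl⟩ := stepEps_iff.1 h
    have ht : t.2 ∈ C.data := Config.mem_data_of_mem_threads (hΔ ▸ Finset.mem_insert_self t Δ)
    refine .inr (stepEps_iff.2 ⟨_, _, _, ?_, hX.mapData (hf C.label_mem_data ht), ?_⟩)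
    · simp only [Config.mapData, hΔ, Finset.image_insert]
    · simp only [Config.mapData, Finset.image_union]

theorem Step.rename (h : M.Step C C') {f : D → D} (hf : f.Injective) :
    M.Step (C.rename f) (C'.rename f) :=
  h.mapData hf.injOn

theorem isRDC_step (M : ARA A Q) : IsRDC (M.Step (D := D)) Config.Below := by
  intro C C' B hB h
  obtain ⟨π, hπ⟩ := Config.below_iff.1 hB
  obtain ⟨B', hB', hs⟩ := h.exists_of_incl hπ
  refine ⟨B'.rename π.symm, Config.below_iff.2 ⟨π, by simpa using hB'⟩, ?_⟩
  obtain hs | rfl := hs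
  · exact .inl (by simpa [Config.rename_rename] using hs.rename π.symm.injective)
  · exact .inr (by simp [Config.rename_rename])

theorem Step.exists_data_subset (h : M.Step C C') : ∃ e, C'.data ⊆ insert e C.data := by
  obtain h | h := h
  · obtain ⟨-, -, α, γ, rfl⟩ := stepMove_iff.1 h
    refine ⟨γ.2, ?_⟩
    rintro _ (rfl | ⟨q, hq⟩)
    · exact Set.mem_insert _ _
    · obtain ⟨q', hq', -⟩ := mem_movedThreads.1 hq
      exact .inr (.inr ⟨q', hq'⟩)
  · obtain ⟨t, Δ, X, hΔ, hX, rfl⟩ := stepEps_iff.1 h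
    obtain ⟨e, he⟩ := hX.exists_snd_mem
    refine ⟨e, ?_⟩
    rintro d (rfl | ⟨q, hq⟩)
    · exact .inr C.label_mem_data
    · obtain hq | hq := Finset.mem_union.1 hq
      · exact (hΔ ▸ he _ hq :)
      · exact .inr (.inr ⟨q, hΔ ▸ Finset.mem_insert_of_mem hq⟩)

/-- A value that a step introduces can be exchanged for any other value that does not occur
before the step. -/
theorem Step.exists_rename_data_subset (h : M.Step C C') {d : D} (hd : d ∉ C.data) :
    ∃ π : Equiv.Perm D, M.Step C (C'.rename π) ∧ (C'.rename π).data ⊆ insert d C.data := by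
  obtain ⟨e, he⟩ := h.exists_data_subset
  by_cases heC : e ∈ C.data
  · rw [Set.insert_eq_of_mem heC] at he
    exact ⟨1, by simpa using h, by simpa using he.trans (Set.subset_insert _ _)⟩
  · have hfix : C.data.EqOn (Equiv.swap e d) id := fun x hx =>
      Equiv.swap_apply_of_ne_of_ne (ne_of_mem_of_not_mem hx heC) (ne_of_mem_of_not_mem hx hd)
    refine ⟨Equiv.swap e d, ?_, ?_⟩
    · simpa [Config.rename_congr hfix] using h.rename (Equiv.swap e d).injective
    · rw [Config.data_rename]
      refine (Set.image_mono he).trans ?_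
      rw [Set.image_insert_eq, Equiv.swap_apply_left, hfix.image_eq, Set.image_id]

/-- The initial configuration over a data word whose first position has type `α` and label `γ`. -/
def initial (M : ARA A Q) (α : WordType) (γ : A × D) : Config A Q D :=
  ⟨0, α, γ, {(M.start, γ.2)}⟩

/-- The configuration is reachable from an initial one. -/
def Reachable (M : ARA A Q) (C : Config A Q D) : Prop :=
  ∃ α γ, Relation.ReflTransGen M.Step (M.initial α γ) C

theorem reachable_initial (M : ARA A Q) (α : WordType) (γ : A × D) :
    M.Reachable (M.initial α γ) :=
  ⟨α, γ, .refl⟩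

theorem Reachable.step (h : M.Reachable C) (h' : M.Step C C') : M.Reachable C' :=
  h.imp fun _ => .imp fun _ h => h.tail h'

theorem Reachable.exists_finite_injOn (h : M.Reachable C) : ∃ V : Set D, V.Finite ∧
    ∀ f : D → D', V.InjOn f → M.Reachable (C.mapData f) := by
  obtain ⟨α, γ, h⟩ := h
  induction h with
  | refl =>
    refine ⟨∅, Set.finite_empty, fun f _ => ?_⟩
    exact M.reachable_initial α (γ.1, f γ.2)
  | @tail B C _ hstep ih =>
    obtain ⟨V, hV, hreach⟩ := ih
    refine ⟨V ∪ B.data, hV.union B.finite_data, fun f hf => ?_⟩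
    exact (hreach f (hf.mono Set.subset_union_left)).step
      (hstep.mapData (hf.mono Set.subset_union_right))

theorem Reachable.rename (h : M.Reachable C) {f : D → D} (hf : f.Injective) :
    M.Reachable (C.rename f) := by
  obtain ⟨V, -, hV⟩ := h.exists_finite_injOn (D' := D)
  exact hV f hf.injOn

theorem exists_reachable_incl_card_le [Finite A] [Finite Q] (M : ARA A Q) :
    ∃ K, ∀ C : Config A Q D, M.Reachable C →
      ∃ C₀, M.Reachable C₀ ∧ C₀.Incl C ∧ C₀.threads.card ≤ K := by
  obtain ⟨b, hb, hfin, hbasis⟩ := exists_finite_basis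
    (Config.wellQuasiOrdered_below (A := A) (Q := Q) (D := D)) {C | M.Reachable C}
  refine ⟨hfin.toFinset.sup fun C => C.threads.card, fun C hC => ?_⟩
  obtain ⟨C₀, hC₀, hbelow⟩ := hbasis C hC
  obtain ⟨π, hπ⟩ := Config.below_iff.1 hbelow
  refine ⟨C₀.rename π, (hb hC₀).rename π.injective, hπ, Finset.card_image_le.trans ?_⟩
  exact Finset.le_sup (f := fun C : Config A Q D => C.threads.card) (hfin.mem_toFinset.2 hC₀)

theorem StepEps.fits {x : List (A × D)} (h : M.StepEps C C') (hC' : C'.Fits x) : C.Fits x := by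
  obtain ⟨t, Δ, X, -, -, rfl⟩ := stepEps_iff.1 h
  exact hC'

theorem exists_chain_fits (h : Relation.ReflTransGen M.Step C C') (p : List (A × D))
    (hp : p.length = C.pos) :
    ∃ y r, (C :: r).IsChain M.Step ∧ (∀ B ∈ C :: r, B.Fits (p ++ y)) ∧
      (C :: r).getLast? = some C' := by
  induction h using Relation.ReflTransGen.head_induction_on generalizing p with
  | refl =>
    cases hα : C'.type with
    | hasNext => exact ⟨[C'.label, C'.label], [], by simp [Config.Fits, hα, ← hp]⟩
    | isLast => exact ⟨[C'.label], [], by simp [Config.Fits, hα, ← hp]⟩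
  | @head C B hs _ ih =>
    obtain ⟨y, r, hr, hfits, hlast, hC⟩ : ∃ y r, (B :: r).IsChain M.Step ∧
        (∀ B' ∈ B :: r, B'.Fits (p ++ y)) ∧ (B :: r).getLast? = some C' ∧ C.Fits (p ++ y) := by
      obtain hmove | heps := hs
      · obtain ⟨-, -, _, _, rfl⟩ := stepMove_iff.1 hmove
        obtain ⟨y, r, hr, hfits, hlast⟩ := ih (p ++ [C.label]) (by simp [hp])
        rw [← List.append_cons] at hfits
        refine ⟨C.label :: y, r, hr, hfits, hlast, ?_⟩
        exact hmove.fits (hfits _ List.mem_cons_self) (by simp [← hp])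
      · obtain ⟨_, _, _, -, -, rfl⟩ := stepEps_iff.1 heps
        obtain ⟨y, r, hr, hfits, hlast⟩ := ih p hp
        exact ⟨y, r, hr, hfits, hlast, heps.fits (hfits _ List.mem_cons_self)⟩
    exact ⟨y, B :: r, List.isChain_cons_cons.2 ⟨hs, hr⟩, List.forall_mem_cons.2 ⟨hC, hfits⟩,
      by simpa using hlast⟩

theorem language_eq_empty_iff (M : ARA A Q) :
    M.language D = ∅ ↔ ∀ C : Config A Q D, M.Reachable C → ¬ C.Accepting := by
  rw [Set.eq_empty_iff_forall_notMem]
  constructor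
  · rintro h C ⟨α, γ, hC⟩ hacc
    obtain ⟨y, r, hr, hfits, hlast⟩ := exists_chain_fits hC [] rfl
    exact h _ ⟨_, ⟨⟨α, γ, rfl⟩, hr, hfits⟩, C, hlast, hacc⟩
  · rintro h x ⟨r, ⟨⟨α, γ, hhead⟩, hr, -⟩, C, hlast, hacc⟩
    obtain ⟨r, rfl⟩ := List.head?_eq_some_iff.1 hhead
    rw [List.getLast?_eq_some_getLast (by simp)] at hlast
    exact h C ⟨α, γ, List.relationReflTransGen_of_exists_isChain_cons r hr
      (Option.some_inj.1 hlast)⟩ hacc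

theorem language_eq_empty_of_infinite [Infinite D'] (h : M.language D' = ∅) :
    M.language D = ∅ := by
  rw [language_eq_empty_iff] at h ⊢
  intro C hC hacc
  obtain ⟨V, hV, hreach⟩ := hC.exists_finite_injOn (D' := D')
  obtain ⟨f, -, hf⟩ := hV.exists_injOn_of_encard_le (t := (Set.univ : Set D')) (by simp)
  exact h _ (hreach f hf) (hacc.mapData f)

end ARA

namespace Config

variable {A : Type v} {Q : Type w} {D : Type u}

theorem Incl.data_subset {C C' : Config A Q D} (h : C.Incl C') : C.data ⊆ C'.data := by
  rintro e (rfl | ⟨q, hq⟩)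
  · exact h.2.1 ▸ C'.label_mem_data
  · exact .inr ⟨q, h.2.2 hq⟩

theorem ncard_data_le (C : Config A Q D) : C.data.ncard ≤ C.threads.card + 1 := by
  rw [data_eq, ← Set.ncard_coe_finset]
  exact (Set.ncard_insert_le _ _).trans (Nat.succ_le_succ (Set.ncard_image_le (Set.toFinite _)))

theorem finite_setOf_data_subset [Finite A] [Finite Q] {V : Set D} (hV : V.Finite) :
    {C : Config A Q D | C.pos = 0 ∧ C.data ⊆ V}.Finite := by
  have hthreads : {Δ : Finset (Q × D) | (Δ : Set (Q × D)) ⊆ Set.univ ×ˢ V}.Finite := by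
    refine ((Set.finite_univ.prod hV).toFinset.powerset.finite_toSet).subset fun Δ hΔ => ?_
    simpa using hΔ
  refine (((Set.finite_univ.prod (Set.finite_univ.prod hV)).prod hthreads).image
    fun x : (WordType × A × D) × Finset (Q × D) => (⟨0, x.1.1, x.1.2, x.2⟩ : Config A Q D)).subset
      ?_
  rintro ⟨_, α, γ, Δ⟩ ⟨rfl, hdata⟩
  refine ⟨((α, γ), Δ), ⟨by simpa using hdata (label_mem_data _), fun t ht => ?_⟩, rfl⟩
  exact ⟨Set.mem_univ _, hdata (mem_data_of_mem_threads ht)⟩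

end Config

namespace ARA

variable {A : Type v} {Q : Type w} [DecidableEq Q] {M : ARA A Q}

/-- A set `B` of non-accepting configurations with data below `N`, each of which leaves a datum
below `N` unused, such that the initial configurations with datum `0` and the successors with data
below `N` of members of `B` all include members of `B`. Such a set shows that the language is empty,
by `IsEmptinessCertificate.language_eq_empty`. -/
structure IsEmptinessCertificate (M : ARA A Q) (N : ℕ) (B : Set (Config A Q ℕ)) : Prop where
  exists_incl_initial (α : WordType) (a : A) : ∃ b ∈ B, b.Incl (M.initial α (a, 0))
  not_accepting : ∀ b ∈ B, ¬ b.Accepting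
  data_subset : ∀ b ∈ B, b.data ⊆ Set.Iio N
  exists_unused : ∀ b ∈ B, ∃ e < N, e ∉ b.data
  exists_incl_of_step : ∀ b ∈ B, ∀ C, M.Step b C → C.data ⊆ Set.Iio N → ∃ b' ∈ B, b'.Incl C

theorem IsEmptinessCertificate.exists_below {N : ℕ} {B : Set (Config A Q ℕ)}
    (hB : M.IsEmptinessCertificate N B) {C : Config A Q ℕ} (hC : M.Reachable C) :
    ∃ b ∈ B, b.Below C := by
  obtain ⟨α, γ, hC⟩ := hC
  induction hC with
  | refl =>
    obtain ⟨b, hb, hincl⟩ := hB.exists_incl_initial α γ.1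
    refine ⟨b, hb, hincl.below.trans (Config.below_iff.2 ⟨Equiv.swap 0 γ.2, rfl, ?_, ?_⟩)⟩ <;>
      simp [initial, Config.rename]
  | @tail C C' _ hstep ih =>
    obtain ⟨b, hb, hbelow⟩ := ih
    obtain ⟨b', hb', hstep' | rfl⟩ := M.isRDC_step C C' b hbelow hstep
    · obtain ⟨e, he, heb⟩ := hB.exists_unused b hb
      obtain ⟨π, hπ, hdata⟩ := hstep'.exists_rename_data_subset heb
      obtain ⟨b'', hb'', hincl⟩ := hB.exists_incl_of_step b hb _ hπ
        (hdata.trans (Set.insert_subset he (hB.data_subset b hb)))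
      have hπb' : (b'.rename π).Below b' :=
        Config.below_iff.2 ⟨π.symm, by simpa [Config.rename_rename] using Config.Incl.refl b'⟩
      exact ⟨b'', hb'', hincl.below.trans (hπb'.trans hb')⟩
    · exact ⟨b, hb, hb'⟩

theorem IsEmptinessCertificate.language_eq_empty {N : ℕ} {B : Set (Config A Q ℕ)}
    (hB : M.IsEmptinessCertificate N B) : M.language ℕ = ∅ := by
  refine M.language_eq_empty_iff.2 fun C hC hacc => ?_
  obtain ⟨b, hb, hbelow⟩ := hB.exists_below hC
  exact hB.not_accepting b hb (hbelow.accepting hacc)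

theorem exists_isEmptinessCertificate [Finite A] [Finite Q] (h : M.language ℕ = ∅) :
    ∃ N B, B.Finite ∧ M.IsEmptinessCertificate N B := by
  rw [language_eq_empty_iff] at h
  obtain ⟨K, hK⟩ := exists_reachable_incl_card_le (D := ℕ) M
  let B : Set (Config A Q ℕ) := {b | b.pos = 0 ∧ b.data ⊆ Set.Iio (K + 2) ∧
    (∃ e < K + 2, e ∉ b.data) ∧ ∃ C, M.Reachable C ∧ C.Incl b}
  have hbasis {C₁ C : Config A Q ℕ} (hC₁ : M.Reachable C₁) (hincl : C₁.Incl C)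
      (hC : C.data ⊆ Set.Iio (K + 2)) : ∃ b ∈ B, b.Incl C := by
    obtain ⟨C₀, hC₀, hincl₀, hcard⟩ := hK C₁ hC₁
    have hC₀C := hincl₀.trans hincl
    have hunused : ∃ e ∈ Set.Iio (K + 2), e ∉ C₀.data :=
      Set.exists_mem_notMem_of_ncard_lt_ncard
        (C₀.ncard_data_le.trans_lt (by simpa using hcard)) C₀.finite_data
    exact ⟨⟨0, C₀.type, C₀.label, C₀.threads⟩,
      ⟨rfl, hC₀C.data_subset.trans hC, hunused, C₀, hC₀, Config.Incl.refl C₀⟩, hC₀C⟩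
  refine ⟨K + 2, B, ?_, ⟨fun α a => ?_, ?_, fun b hb => hb.2.1, fun b hb => hb.2.2.1, ?_⟩⟩
  · exact (Config.finite_setOf_data_subset (Set.finite_Iio (K + 2))).subset
      fun b hb => ⟨hb.1, hb.2.1⟩
  · refine hbasis (M.reachable_initial α (a, 0)) (Config.Incl.refl _) ?_
    rintro e (rfl | ⟨q, hq⟩)
    · simp [initial]
    · simp_all [initial]
  · rintro b ⟨-, -, -, C, hC, hincl⟩ hacc
    exact h C hC (hincl.below.accepting hacc)
  · rintro b ⟨-, -, -, C, hC, hincl⟩ C' hstep hdata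
    obtain ⟨C₁, hC₁, hstep | rfl⟩ := hstep.exists_of_incl hincl
    · exact hbasis (hC.step hstep) hC₁ hdata
    · exact hbasis hC hC₁ hdata

end ARA

/-- A configuration over numbered letters and states, without its position: the number of the type,
the number of the letter, the datum, and the threads. -/
abbrev CodedConfig := ℕ × ℕ × ℕ × List (ℕ × ℕ)

/-- The type of the descriptions `ARA.code` of automata. -/
abbrev ARACode := ℕ × ℕ × List (ℕ × ℕ × ℕ)

/-- The number of a word type in `Instr.code`. -/
def WordType.num : WordType → ℕ
  | hasNext => 0
  | isLast => 1

theorem WordType.num_injective : Function.Injective WordType.num := by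
  rintro (_ | _) (_ | _) h <;> simp_all [num]

theorem WordType.mem_iff_exists_num {x : ℕ} : x ∈ [0, 1] ↔ ∃ α, num α = x := by
  constructor
  · simp only [List.mem_cons, List.not_mem_nil, or_false]
    rintro (rfl | rfl)
    exacts [⟨hasNext, rfl⟩, ⟨isLast, rfl⟩]
  · rintro ⟨_ | _, rfl⟩ <;> simp [num]

namespace ARACode

/-- The coded instruction of the state `q`. -/
def instr (a : ARACode) (q : ℕ) : ℕ × ℕ × ℕ := a.2.2.getD q (0, 0, 0)

/-- The coded counterpart of `ARA.Effect`: the lists of threads by which a thread with the coded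
instruction `φ` and the datum `e` may be replaced in a configuration of the type and label of `c`,
when the other threads are `r` and only data below `N` are guessed. The entries of the table follow
the tags of `Instr.code`. -/
def replacements (a : ARACode) (N : ℕ) (c : CodedConfig) (r : List (ℕ × ℕ)) (φ : ℕ × ℕ × ℕ)
    (e : ℕ) : List (List (ℕ × ℕ)) :=
  [if φ.2.1 = c.2.1 then [[]] else [],
    if φ.2.1 ≠ c.2.1 then [[]] else [],
    if φ.2.1 = c.1 then [[]] else [],
    [[(φ.2.1, c.2.2.1)]],
    if c.2.2.1 = e then [[]] else [],
    if c.2.2.1 ≠ e then [[]] else [],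
    [[(φ.2.1, e), (φ.2.2, e)]],
    [[(φ.2.1, e)], [(φ.2.2, e)]],
    [],
    (List.range N).map fun d => [(φ.2.1, d)],
    if ∀ s ∈ r, (a.instr s.1).1 = 10 ∨ (a.instr s.1).1 = 8 then
      [(r.filter fun s => s.1 = φ.2.1).map fun s => (φ.2.2, s.2)] else []].getD φ.1 []

/-- The coded configurations after the non-moving transitions of `c`, when only data below `N` are
guessed. -/
def epsSuccessors (a : ARACode) (N : ℕ) (c : CodedConfig) : List CodedConfig :=
  c.2.2.2.flatMap fun t =>
    (a.replacements N c (c.2.2.2.filter fun s => s ≠ t) (a.instr t.1) t.2).map fun X =>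
      (c.1, c.2.1, c.2.2.1, X ++ c.2.2.2.filter fun s => s ≠ t)

/-- The coded configurations after the moving transitions of `c` to a datum below `N`. -/
def moveSuccessors (a : ARACode) (N : ℕ) (c : CodedConfig) : List CodedConfig :=
  if c.1 = 0 ∧ ∀ s ∈ c.2.2.2, (a.instr s.1).1 = 8 then
    [0, 1] ×ˢ List.range a.1 ×ˢ List.range N ×ˢ
      [c.2.2.2.map fun s => ((a.instr s.1).2.1, s.2)]
  else []

/-- The coded configurations after the transitions of `c` that introduce only data below `N`. -/
def successors (a : ARACode) (N : ℕ) (c : CodedConfig) : List CodedConfig :=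
  a.epsSuccessors N c ++ a.moveSuccessors N c

/-- The coded initial configurations with datum below `N`. -/
def initials (a : ARACode) (N : ℕ) : List CodedConfig :=
  ([0, 1] ×ˢ List.range a.1 ×ˢ List.range N).map fun x =>
    (x.1, x.2.1, x.2.2, [(a.2.1, x.2.2)])

end ARACode

section Coding

variable {A : Type v} {Q : Type w} {k n : ℕ} (eA : A ≃ Fin k) (eQ : Q ≃ Fin n)

/-- A thread with the number of its state. -/
def codeThread (t : Q × ℕ) : ℕ × ℕ := (eQ t.1, t.2)

theorem codeThread_injective : Function.Injective (codeThread eQ) := by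
  rintro ⟨q, e⟩ ⟨q', e'⟩ h
  simpa [codeThread, Fin.val_inj] using h

theorem Instr.isMoving_iff_code {φ : Instr A Q} : φ.IsMoving ↔ (φ.code eA eQ).1 = 8 := by
  rcases φ with _ | _ | ⟨_ | _⟩ | _ | _ | _ | _ | _ | _ | _ | _ <;> simp [IsMoving, code]

theorem Instr.isSpread_iff_code {φ : Instr A Q} : φ.IsSpread ↔ (φ.code eA eQ).1 = 10 := by
  rcases φ with _ | _ | ⟨_ | _⟩ | _ | _ | _ | _ | _ | _ | _ | _ <;> simp [IsSpread, code]

@[simp]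
theorem ARA.instr_code (M : ARA A Q) (q : Q) :
    ARACode.instr (M.code eA eQ) (eQ q) = (M.δ q).code eA eQ := by
  simp [ARACode.instr, code]

theorem mem_iff_of_toFinset_eq {Δ : Finset (Q × ℕ)} {r : List (ℕ × ℕ)}
    (hr : r.toFinset = Δ.image (codeThread eQ)) {s : ℕ × ℕ} :
    s ∈ r ↔ ∃ t ∈ Δ, codeThread eQ t = s := by
  rw [← List.mem_toFinset, hr, Finset.mem_image]

theorem forall_mem_iff_of_toFinset_eq {Δ : Finset (Q × ℕ)} {r : List (ℕ × ℕ)}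
    (hr : r.toFinset = Δ.image (codeThread eQ)) {p : ℕ × ℕ → Prop} :
    (∀ s ∈ r, p s) ↔ ∀ t ∈ Δ, p (codeThread eQ t) := by
  simp only [← List.mem_toFinset, hr, Finset.forall_mem_image]

theorem toFinset_map_filter_state [DecidableEq Q] {Δ : Finset (Q × ℕ)} {r : List (ℕ × ℕ)}
    (hr : r.toFinset = Δ.image (codeThread eQ)) (q₁ q₂ : Q) :
    ((r.filter fun s => s.1 = (eQ q₂ : ℕ)).map fun s => ((eQ q₁ : ℕ), s.2)).toFinset =
      ((Δ.filter fun t => t.1 = q₂).image fun t => (q₁, t.2)).image (codeThread eQ) := by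
  ext s
  simp [mem_iff_of_toFinset_eq eQ hr, codeThread, Fin.val_inj]

theorem forall_isSpread_or_isMoving_iff_code (M : ARA A Q) {Δ : Finset (Q × ℕ)}
    {r : List (ℕ × ℕ)} (hr : r.toFinset = Δ.image (codeThread eQ)) :
    (∀ t ∈ Δ, (M.δ t.1).IsSpread ∨ (M.δ t.1).IsMoving) ↔
      ∀ s ∈ r, (ARACode.instr (M.code eA eQ) s.1).1 = 10 ∨
        (ARACode.instr (M.code eA eQ) s.1).1 = 8 := by
  simp only [forall_mem_iff_of_toFinset_eq eQ hr, codeThread, ARA.instr_code,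
    Instr.isSpread_iff_code eA eQ, Instr.isMoving_iff_code eA eQ]

theorem forall_isMoving_iff_code (M : ARA A Q) {Δ : Finset (Q × ℕ)} {r : List (ℕ × ℕ)}
    (hr : r.toFinset = Δ.image (codeThread eQ)) :
    (∀ t ∈ Δ, (M.δ t.1).IsMoving) ↔
      ∀ s ∈ r, (ARACode.instr (M.code eA eQ) s.1).1 = 8 := by
  simp only [forall_mem_iff_of_toFinset_eq eQ hr, codeThread, ARA.instr_code,
    Instr.isMoving_iff_code eA eQ]

/-- `c` describes `C`, up to the position, in the given numberings of letters and states. -/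
structure CodedConfig.Codes [DecidableEq Q] (c : CodedConfig) (C : Config A Q ℕ) : Prop where
  type_eq : c.1 = C.type.num
  letter_eq : c.2.1 = eA C.label.1
  datum_eq : c.2.2.1 = C.label.2
  toFinset_threads : c.2.2.2.toFinset = C.threads.image (codeThread eQ)

namespace CodedConfig

variable {eA eQ} [DecidableEq Q] {M : ARA A Q} {c c' : CodedConfig} {C C' : Config A Q ℕ}

theorem exists_codes (C : Config A Q ℕ) : ∃ c : CodedConfig, c.Codes eA eQ C :=
  ⟨(C.type.num, eA C.label.1, C.label.2, (C.threads.image (codeThread eQ)).toList), rfl, rfl, rfl,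
    Finset.toList_toFinset _⟩

theorem Codes.mem_threads_iff (h : c.Codes eA eQ C) {s : ℕ × ℕ} :
    s ∈ c.2.2.2 ↔ ∃ t ∈ C.threads, codeThread eQ t = s :=
  mem_iff_of_toFinset_eq eQ h.toFinset_threads

theorem Codes.codeThread_mem_threads_iff (h : c.Codes eA eQ C) {t : Q × ℕ} :
    codeThread eQ t ∈ c.2.2.2 ↔ t ∈ C.threads := by
  rw [← List.mem_toFinset, h.toFinset_threads, (codeThread_injective eQ).mem_finset_image]

theorem exists_mem_replacements_of_effect {Δ X : Finset (Q × ℕ)} {t : Q × ℕ} {r : List (ℕ × ℕ)}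
    (h : c.Codes eA eQ C) (hr : r.toFinset = Δ.image (codeThread eQ))
    (hX : M.Effect C.type C.label Δ t X) {N : ℕ} (hN : ∀ s ∈ X, s.2 < N) :
    ∃ Y ∈ ARACode.replacements (M.code eA eQ) N c r ((M.δ t.1).code eA eQ) t.2,
      Y.toFinset = X.image (codeThread eQ) := by
  unfold ARA.Effect at hX
  split at hX
  all_goals rw [‹M.δ t.1 = _›]
  case h_3 β _ =>
    cases β <;>
      simp [ARACode.replacements, Instr.code, h.type_eq, WordType.num, ← hX.1, hX.2]
  case h_8 =>
    obtain rfl | rfl := hX <;> simp [ARACode.replacements, Instr.code, codeThread]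
  case h_9 => exact hX.elim
  case h_10 =>
    obtain ⟨e, rfl⟩ := hX
    simpa [ARACode.replacements, Instr.code, codeThread] using hN
  case h_11 =>
    obtain ⟨hΔ, rfl⟩ := hX
    refine ⟨_, ?_, toFinset_map_filter_state eQ hr _ _⟩
    simp only [ARACode.replacements, Instr.code, List.getD_cons_succ, List.getD_cons_zero,
      List.mem_ite_nil_right, List.mem_singleton]
    exact ⟨(forall_isSpread_or_isMoving_iff_code eA eQ M hr).1 hΔ, rfl⟩
  all_goals simp [*, ARACode.replacements, Instr.code, h.letter_eq, h.datum_eq, codeThread,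
    Fin.val_inj, Finset.image_insert]

theorem exists_effect_of_mem_replacements {Δ : Finset (Q × ℕ)} {t : Q × ℕ} {r Y : List (ℕ × ℕ)}
    {N : ℕ} (h : c.Codes eA eQ C) (hr : r.toFinset = Δ.image (codeThread eQ))
    (hY : Y ∈ ARACode.replacements (M.code eA eQ) N c r ((M.δ t.1).code eA eQ) t.2) :
    ∃ X, M.Effect C.type C.label Δ t X ∧ Y.toFinset = X.image (codeThread eQ) := by
  unfold ARA.Effect
  rcases hφ : M.δ t.1 with _ | _ | β | _ | _ | _ | _ | _ | _ | _ | _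
  all_goals
    rw [hφ] at hY
    dsimp only
  case test =>
    cases β <;> cases hα : C.type <;>
      simp_all [ARACode.replacements, Instr.code, h.type_eq, WordType.num]
  case spread =>
    simp only [ARACode.replacements, Instr.code, List.getD_cons_succ, List.getD_cons_zero,
      List.mem_ite_nil_right, List.mem_singleton,
      ← forall_isSpread_or_isMoving_iff_code eA eQ M hr] at hY
    obtain ⟨hΔ, rfl⟩ := hY
    exact ⟨_, ⟨hΔ, rfl⟩, toFinset_map_filter_state eQ hr _ _⟩
  all_goals simp only [ARACode.replacements, Instr.code, List.getD_cons_succ, List.getD_cons_zero,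
    List.mem_ite_nil_right, List.mem_cons, List.not_mem_nil, or_false, List.mem_map,
    h.letter_eq, h.datum_eq] at hY
  case letter | notLetter =>
    simp only [ne_eq, Fin.val_inj, eA.apply_eq_iff_eq] at hY
    simp [hY]
  case or => obtain rfl | rfl := hY <;> simp [codeThread]
  case guess => obtain ⟨e, -, rfl⟩ := hY; simp [codeThread]
  all_goals simp [hY, codeThread, Finset.image_insert]

theorem Codes.toFinset_filter_ne (h : c.Codes eA eQ C) (t : Q × ℕ) :
    (c.2.2.2.filter fun s => s ≠ codeThread eQ t).toFinset =
      (C.threads.erase t).image (codeThread eQ) := by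
  rw [List.toFinset_filter, h.toFinset_threads, Finset.filter_image]
  congr 1
  ext s
  simp [(codeThread_injective eQ).eq_iff, and_comm]

theorem Codes.exists_stepEps_of_mem (h : c.Codes eA eQ C) {N : ℕ}
    (hc' : c' ∈ ARACode.epsSuccessors (M.code eA eQ) N c) :
    ∃ C', M.StepEps C C' ∧ c'.Codes eA eQ C' := by
  simp only [ARACode.epsSuccessors, List.mem_flatMap, List.mem_map] at hc'
  obtain ⟨s, hs, Y, hY, rfl⟩ := hc'
  obtain ⟨t, ht, rfl⟩ := h.mem_threads_iff.1 hs
  have hr := h.toFinset_filter_ne t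
  simp only [codeThread, ARA.instr_code] at hY hr
  obtain ⟨X, hX, hYX⟩ := exists_effect_of_mem_replacements h hr hY
  refine ⟨_, ARA.stepEps_iff.2 ⟨t, _, X, (Finset.insert_erase ht).symm, hX, rfl⟩,
    h.type_eq, h.letter_eq, h.datum_eq, ?_⟩
  simp only [List.toFinset_append, hYX, Finset.image_union, codeThread, hr]

theorem Codes.exists_mem_of_stepEps (h : c.Codes eA eQ C) (hC : M.StepEps C C') {N : ℕ}
    (hN : C'.data ⊆ Set.Iio N) :
    ∃ c' ∈ ARACode.epsSuccessors (M.code eA eQ) N c, ∃ B, B.Incl C' ∧ c'.Codes eA eQ B := by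
  obtain ⟨t, Δ, X, hΔ, hX, rfl⟩ := ARA.stepEps_iff.1 hC
  have hΔ' : C.threads.erase t ⊆ Δ := hΔ ▸ Finset.erase_insert_subset t Δ
  obtain ⟨X', hXX', hX'⟩ := hX.mono hΔ'
  have hr := h.toFinset_filter_ne t
  obtain ⟨Y, hY, hYX⟩ := exists_mem_replacements_of_effect h hr hX' fun s hs =>
    hN (Config.mem_data_of_mem_threads (Finset.mem_union_left _ (hXX' hs)))
  refine ⟨(c.1, c.2.1, c.2.2.1, Y ++ c.2.2.2.filter fun s => s ≠ codeThread eQ t),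
    List.mem_flatMap.2 ⟨codeThread eQ t, h.codeThread_mem_threads_iff.2 ?_,
      List.mem_map.2 ⟨Y, ?_, rfl⟩⟩, ⟨C.pos, C.type, C.label, X' ∪ C.threads.erase t⟩,
    ⟨rfl, rfl, Finset.union_subset_union hXX' hΔ'⟩, h.type_eq, h.letter_eq, h.datum_eq, ?_⟩
  · exact hΔ ▸ Finset.mem_insert_self t Δ
  · simpa only [codeThread, ARA.instr_code] using hY
  · simp only [List.toFinset_append, hYX, Finset.image_union, hr]

theorem Codes.toFinset_movedThreads (h : c.Codes eA eQ C)
    (hC : ∀ t ∈ C.threads, (M.δ t.1).IsMoving) :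
    (c.2.2.2.map fun s => ((ARACode.instr (M.code eA eQ) s.1).2.1, s.2)).toFinset =
      (M.movedThreads C.threads).image (codeThread eQ) := by
  ext s
  simp only [List.mem_toFinset, List.mem_map, h.mem_threads_iff, Finset.mem_image,
    ARA.mem_movedThreads, exists_exists_and_eq_and]
  constructor
  · rintro ⟨t, ht, rfl⟩
    obtain ⟨q, hq⟩ := hC t ht
    exact ⟨(q, t.2), ⟨t.1, ht, hq⟩, by simp [codeThread, hq, Instr.code]⟩
  · rintro ⟨⟨q, e⟩, ⟨q', ht, hq⟩, rfl⟩
    exact ⟨(q', e), ht, by simp [codeThread, hq, Instr.code]⟩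

theorem Codes.exists_stepMove_of_mem (h : c.Codes eA eQ C) {N : ℕ}
    (hc' : c' ∈ ARACode.moveSuccessors (M.code eA eQ) N c) :
    ∃ C', M.StepMove C C' ∧ c'.Codes eA eQ C' := by
  obtain ⟨α', a, e, l⟩ := c'
  simp only [ARACode.moveSuccessors, List.mem_ite_nil_right, List.mem_product,
    ← forall_isMoving_iff_code eA eQ M h.toFinset_threads, List.mem_singleton, List.mem_range,
    WordType.mem_iff_exists_num, h.type_eq] at hc'
  obtain ⟨⟨hα, hmov⟩, ⟨α, rfl⟩, ha, -, rfl⟩ := hc'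
  exact ⟨⟨C.pos + 1, α, (eA.symm ⟨a, ha⟩, e), M.movedThreads C.threads⟩,
    ARA.stepMove_iff.2 ⟨WordType.num_injective hα, hmov, α, _, rfl⟩,
    rfl, by simp, rfl, h.toFinset_movedThreads hmov⟩

theorem Codes.exists_mem_of_stepMove (h : c.Codes eA eQ C) (hC : M.StepMove C C') {N : ℕ}
    (hN : C'.data ⊆ Set.Iio N) :
    ∃ c' ∈ ARACode.moveSuccessors (M.code eA eQ) N c, c'.Codes eA eQ C' := by
  obtain ⟨hα, hmov, α, γ, rfl⟩ := ARA.stepMove_iff.1 hC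
  refine ⟨(α.num, eA γ.1, γ.2, _), ?_, rfl, rfl, rfl, h.toFinset_movedThreads hmov⟩
  simp only [ARACode.moveSuccessors, List.mem_ite_nil_right, List.mem_product,
    ← forall_isMoving_iff_code eA eQ M h.toFinset_threads, List.mem_singleton, List.mem_range,
    WordType.mem_iff_exists_num, h.type_eq, hα]
  exact ⟨⟨rfl, hmov⟩, ⟨α, rfl⟩, (eA γ.1).2, hN (Config.label_mem_data _), trivial⟩

theorem Codes.exists_step_of_mem_successors (h : c.Codes eA eQ C) {N : ℕ}
    (hc' : c' ∈ ARACode.successors (M.code eA eQ) N c) :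
    ∃ C', M.Step C C' ∧ c'.Codes eA eQ C' := by
  obtain hc' | hc' := List.mem_append.1 hc'
  · exact (h.exists_stepEps_of_mem hc').imp fun _ => .imp_left .inr
  · exact (h.exists_stepMove_of_mem hc').imp fun _ => .imp_left .inl

theorem Codes.exists_mem_successors_of_step (h : c.Codes eA eQ C) (hC : M.Step C C') {N : ℕ}
    (hN : C'.data ⊆ Set.Iio N) :
    ∃ c' ∈ ARACode.successors (M.code eA eQ) N c, ∃ B, B.Incl C' ∧ c'.Codes eA eQ B := by
  simp only [ARACode.successors, List.mem_append, or_and_right, exists_or]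
  refine hC.symm.imp (h.exists_mem_of_stepEps · hN) fun hC => ?_
  exact (h.exists_mem_of_stepMove hC hN).imp fun _ => .imp_right fun hc' => ⟨_, .refl _, hc'⟩

end CodedConfig

end Coding

namespace CodedConfig

/-- The coded counterpart of `Config.Incl`. -/
def Incl (c c' : CodedConfig) : Prop :=
  c.1 = c'.1 ∧ c.2.1 = c'.2.1 ∧ c.2.2.1 = c'.2.2.1 ∧ ∀ s ∈ c.2.2.2, s ∈ c'.2.2.2

/-- The coded counterpart of `Config.data`. -/
def data (c : CodedConfig) : List ℕ := c.2.2.1 :: c.2.2.2.map Prod.snd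

section

variable {A : Type v} {Q : Type w} {k n : ℕ} {eA : A ≃ Fin k} {eQ : Q ≃ Fin n} [DecidableEq Q]
  {M : ARA A Q} {c c' : CodedConfig} {C C' : Config A Q ℕ} {N : ℕ}

theorem Codes.threads_eq_nil_iff (h : c.Codes eA eQ C) : c.2.2.2 = [] ↔ C.Accepting := by
  rw [← List.toFinset_eq_empty_iff, h.toFinset_threads, Finset.image_eq_empty, Config.Accepting]

theorem Codes.mem_data_iff (h : c.Codes eA eQ C) {e : ℕ} : e ∈ c.data ↔ e ∈ C.data := by
  rw [data, List.mem_cons, h.datum_eq]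
  refine or_congr_right ⟨fun he => ?_, fun ⟨q, hq⟩ => ?_⟩
  · obtain ⟨s, hs, rfl⟩ := List.mem_map.1 he
    obtain ⟨t, ht, rfl⟩ := h.mem_threads_iff.1 hs
    exact ⟨t.1, ht⟩
  · exact List.mem_map.2 ⟨_, h.codeThread_mem_threads_iff.2 hq, rfl⟩

theorem Codes.data_subset_Iio_iff (h : c.Codes eA eQ C) :
    C.data ⊆ Set.Iio N ↔ ∀ e ∈ c.data, e < N := by
  simp only [h.mem_data_iff]
  rfl

theorem Codes.incl (h : c.Codes eA eQ C) (h' : c'.Codes eA eQ C') (hC : C.Incl C') :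
    c.Incl c' := by
  refine ⟨by rw [h.type_eq, h'.type_eq, hC.1], by rw [h.letter_eq, h'.letter_eq, hC.2.1],
    by rw [h.datum_eq, h'.datum_eq, hC.2.1], fun s hs => ?_⟩
  obtain ⟨t, ht, rfl⟩ := h.mem_threads_iff.1 hs
  exact h'.codeThread_mem_threads_iff.2 (hC.2.2 ht)

theorem Codes.exists_incl_of_incl (h' : c'.Codes eA eQ C') (hc : c.Incl c') :
    ∃ C, C.Incl C' ∧ c.Codes eA eQ C := by
  refine ⟨⟨C'.pos, C'.type, C'.label, C'.threads.filter fun t => codeThread eQ t ∈ c.2.2.2⟩,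
    ⟨rfl, rfl, Finset.filter_subset _ _⟩, hc.1.trans h'.type_eq, hc.2.1.trans h'.letter_eq,
    hc.2.2.1.trans h'.datum_eq, ?_⟩
  ext s
  simp only [List.mem_toFinset, Finset.mem_image, Finset.mem_filter]
  constructor
  · intro hs
    obtain ⟨t, ht, rfl⟩ := h'.mem_threads_iff.1 (hc.2.2.2 s hs)
    exact ⟨t, ⟨ht, hs⟩, rfl⟩
  · rintro ⟨t, ⟨-, ht⟩, rfl⟩
    exact ht

theorem exists_codes_initial_of_mem (hc : c ∈ ARACode.initials (M.code eA eQ) N) :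
    ∃ α a, ∃ e < N, c.Codes eA eQ (M.initial α (a, e)) := by
  obtain ⟨⟨x, a, e⟩, hx, rfl⟩ := List.mem_map.1 hc
  simp only [List.mem_product, List.mem_range, WordType.mem_iff_exists_num] at hx
  obtain ⟨⟨α, rfl⟩, ha, he⟩ := hx
  exact ⟨α, eA.symm ⟨a, ha⟩, e, he, rfl, by simp [ARA.initial], rfl,
    by simp [ARA.initial, ARA.code, codeThread]⟩

theorem exists_mem_initials (M : ARA A Q) (α : WordType) (a : A) {e : ℕ} (he : e < N) :
    ∃ c ∈ ARACode.initials (M.code eA eQ) N, c.Codes eA eQ (M.initial α (a, e)) := by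
  refine ⟨(α.num, eA a, e, [((eQ M.start : ℕ), e)]), ?_, rfl, rfl, rfl,
    by simp [ARA.initial, codeThread]⟩
  refine List.mem_map.2 ⟨(α.num, eA a, e), ?_, rfl⟩
  simp only [List.mem_product, List.mem_range, WordType.mem_iff_exists_num]
  exact ⟨⟨α, rfl⟩, (eA a).2, he⟩

end

end CodedConfig

namespace ARACode

/-- The coded counterpart of `ARA.IsEmptinessCertificate`, for finite sets of configurations. -/
def IsEmptinessCertificate (a : ARACode) (N : ℕ) (B : List CodedConfig) : Prop :=
  (∀ c ∈ a.initials 1, ∃ b ∈ B, b.Incl c) ∧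
    ∀ b ∈ B, b.2.2.2 ≠ [] ∧ (∀ e ∈ b.data, e < N) ∧ (∃ e < N, e ∉ b.data) ∧
      ∀ c ∈ a.successors N b, (∀ e ∈ c.data, e < N) → ∃ b' ∈ B, b'.Incl c

/-- The coded configurations that are reached in fewer than `m` transitions with data below `m`. -/
def reached (a : ARACode) : ℕ → List CodedConfig
  | 0 => []
  | m + 1 => a.initials (m + 1) ++ a.reached m ++ (a.reached m).flatMap (a.successors (m + 1))

theorem reached_subset (a : ARACode) {m m' : ℕ} (h : m ≤ m') : a.reached m ⊆ a.reached m' := by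
  induction h with
  | refl => exact List.Subset.refl _
  | step _ ih => exact fun c hc => List.mem_append_left _ (List.mem_append_right _ (ih hc))

variable {A : Type v} {Q : Type w} {k n : ℕ} {eA : A ≃ Fin k} {eQ : Q ≃ Fin n} [DecidableEq Q]
  {M : ARA A Q} {c : CodedConfig} {m : ℕ}

theorem IsEmptinessCertificate.isEmptinessCertificate_setOf_codes {N : ℕ} {B : List CodedConfig}
    (hB : IsEmptinessCertificate (M.code eA eQ) N B) :
    M.IsEmptinessCertificate N {C | ∃ b ∈ B, b.Codes eA eQ C} := by
  obtain ⟨hinit, hB⟩ := hB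
  have hincl {c : CodedConfig} {C : Config A Q ℕ} (hc : c.Codes eA eQ C) :
      (∃ b ∈ B, b.Incl c) → ∃ C' ∈ {C | ∃ b ∈ B, b.Codes eA eQ C}, C'.Incl C := by
    rintro ⟨b, hb, hbc⟩
    obtain ⟨C', hC', hbC'⟩ := hc.exists_incl_of_incl hbc
    exact ⟨C', ⟨b, hb, hbC'⟩, hC'⟩
  refine ⟨fun α a => ?_, ?_, ?_, ?_, ?_⟩
  · obtain ⟨c, hc, hcodes⟩ := CodedConfig.exists_mem_initials M α a one_pos
    exact hincl hcodes (hinit c hc)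
  · rintro C ⟨b, hb, hcodes⟩
    exact hcodes.threads_eq_nil_iff.not.1 (hB b hb).1
  · rintro C ⟨b, hb, hcodes⟩
    exact hcodes.data_subset_Iio_iff.2 (hB b hb).2.1
  · rintro C ⟨b, hb, hcodes⟩
    simpa only [hcodes.mem_data_iff] using (hB b hb).2.2.1
  · rintro C ⟨b, hb, hcodes⟩ C' hstep hdata
    obtain ⟨c, hc, C'', hC'', hcodes'⟩ := hcodes.exists_mem_successors_of_step hstep hdata
    obtain ⟨b', hb', hb'C⟩ := hincl hcodes' ((hB b hb).2.2.2 c hc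
      (hcodes'.data_subset_Iio_iff.1 (hC''.data_subset.trans hdata)))
    exact ⟨b', hb', hb'C.trans hC''⟩

theorem exists_isEmptinessCertificate_of_finite {N : ℕ} {B : Set (Config A Q ℕ)}
    (hB : M.IsEmptinessCertificate N B) (hfin : B.Finite) (eA : A ≃ Fin k) (eQ : Q ≃ Fin n) :
    ∃ B', IsEmptinessCertificate (M.code eA eQ) N B' := by
  choose f hf using CodedConfig.exists_codes (eA := eA) (eQ := eQ)
  have hmem {c : CodedConfig} : c ∈ hfin.toFinset.toList.map f ↔ ∃ b ∈ B, f b = c := by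
    simp only [List.mem_map, Finset.mem_toList, hfin.mem_toFinset]
  have hincl {c : CodedConfig} {C : Config A Q ℕ} (hc : c.Codes eA eQ C) :
      (∃ b ∈ B, b.Incl C) → ∃ b ∈ hfin.toFinset.toList.map f, b.Incl c := by
    rintro ⟨b, hb, hbC⟩
    exact ⟨f b, hmem.2 ⟨b, hb, rfl⟩, (hf b).incl hc hbC⟩
  refine ⟨hfin.toFinset.toList.map f, fun c hc => ?_, fun c hc => ?_⟩
  · obtain ⟨α, a, e, he, hcodes⟩ := CodedConfig.exists_codes_initial_of_mem hc
    obtain rfl := Nat.lt_one_iff.1 he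
    exact hincl hcodes (hB.exists_incl_initial α a)
  · obtain ⟨b, hb, rfl⟩ := hmem.1 hc
    refine ⟨(hf b).threads_eq_nil_iff.not.2 (hB.not_accepting b hb),
      (hf b).data_subset_Iio_iff.1 (hB.data_subset b hb), ?_, fun c' hc' hdata => ?_⟩
    · simpa only [(hf b).mem_data_iff] using hB.exists_unused b hb
    · obtain ⟨C, hstep, hcodes⟩ := (hf b).exists_step_of_mem_successors hc'
      exact hincl hcodes (hB.exists_incl_of_step b hb C hstep (hcodes.data_subset_Iio_iff.2 hdata))

theorem exists_reachable_of_mem_reached (hc : c ∈ reached (M.code eA eQ) m) :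
    ∃ C, M.Reachable C ∧ c.Codes eA eQ C := by
  induction m generalizing c with
  | zero => exact absurd hc List.not_mem_nil
  | succ m ih =>
    simp only [reached, List.mem_append, List.mem_flatMap] at hc
    obtain (hc | hc) | ⟨b, hb, hc⟩ := hc
    · obtain ⟨α, a, e, -, hcodes⟩ := CodedConfig.exists_codes_initial_of_mem hc
      exact ⟨_, M.reachable_initial α (a, e), hcodes⟩
    · exact ih hc
    · obtain ⟨C, hC, hbC⟩ := ih hb
      obtain ⟨C', hstep, hcodes⟩ := hbC.exists_step_of_mem_successors hc
      exact ⟨C', hC.step hstep, hcodes⟩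

theorem exists_mem_reached_of_reachable (eA : A ≃ Fin k) (eQ : Q ≃ Fin n) {C : Config A Q ℕ}
    (hC : M.Reachable C) :
    ∃ m, ∃ c ∈ reached (M.code eA eQ) m, ∃ B, B.Incl C ∧ c.Codes eA eQ B := by
  obtain ⟨α, γ, hC⟩ := hC
  induction hC with
  | refl =>
    obtain ⟨c, hc, hcodes⟩ := CodedConfig.exists_mem_initials M α γ.1 γ.2.lt_succ_self
    exact ⟨γ.2 + 1, c, List.mem_append_left _ (List.mem_append_left _ hc), _, .refl _, hcodes⟩
  | tail _ hstep ih =>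
    obtain ⟨m, c, hc, B, hBC, hcodes⟩ := ih
    obtain ⟨B', hB', hstep' | rfl⟩ := hstep.exists_of_incl hBC
    · obtain ⟨N, hN⟩ := B'.finite_data.bddAbove
      have hdata : B'.data ⊆ Set.Iio (max m N + 1) := fun e he =>
        Nat.lt_succ_of_le ((hN he).trans (le_max_right m N))
      obtain ⟨c', hc', B'', hB'', hcodes'⟩ := hcodes.exists_mem_successors_of_step hstep' hdata
      exact ⟨max m N + 1, c', List.mem_append_right _ (List.mem_flatMap.2
        ⟨c, reached_subset _ (le_max_left m N) hc, hc'⟩), B'', hB''.trans hB', hcodes'⟩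
    · exact ⟨m, c, hc, B, hB', hcodes⟩

theorem exists_isEmptinessCertificate_iff (M : ARA A Q) (eA : A ≃ Fin k) (eQ : Q ≃ Fin n) :
    (∃ N B, IsEmptinessCertificate (M.code eA eQ) N B) ↔ M.language ℕ = ∅ := by
  constructor
  · rintro ⟨N, B, hB⟩
    exact hB.isEmptinessCertificate_setOf_codes.language_eq_empty
  · intro h
    have : Finite A := .of_equiv _ eA.symm
    have : Finite Q := .of_equiv _ eQ.symm
    obtain ⟨N, B, hfin, hB⟩ := ARA.exists_isEmptinessCertificate h
    exact ⟨N, exists_isEmptinessCertificate_of_finite hB hfin eA eQ⟩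

theorem exists_mem_reached_iff (M : ARA A Q) (eA : A ≃ Fin k) (eQ : Q ≃ Fin n) :
    (∃ m, ∃ c ∈ reached (M.code eA eQ) m, c.2.2.2 = []) ↔ M.language ℕ ≠ ∅ := by
  rw [Ne, ARA.language_eq_empty_iff]
  push Not
  constructor
  · rintro ⟨m, c, hc, hnil⟩
    obtain ⟨C, hC, hcodes⟩ := exists_reachable_of_mem_reached hc
    exact ⟨C, hC, hcodes.threads_eq_nil_iff.1 hnil⟩
  · rintro ⟨C, hC, hacc⟩
    obtain ⟨m, c, hc, B, hBC, hcodes⟩ := exists_mem_reached_of_reachable eA eQ hC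
    exact ⟨m, c, hc, hcodes.threads_eq_nil_iff.2 (hBC.below.accepting hacc)⟩

end ARACode

section Computability

variable {α β γ : Type*} [Primcodable α] [Primcodable β] [Primcodable γ]

theorem primrecPred_forall_mem {p : α → β → Prop} {f : α → List β} (hf : Primrec f)
    (hp : PrimrecPred fun x : α × β => p x.1 x.2) : PrimrecPred fun a => ∀ b ∈ f a, p a b :=
  have hp' : PrimrecRel fun b a => p a b := hp.comp (Primrec.snd.pair Primrec.fst)
  hp'.forall_mem_list.comp hf Primrec.id

theorem primrecPred_exists_mem {p : α → β → Prop} {f : α → List β} (hf : Primrec f)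
    (hp : PrimrecPred fun x : α × β => p x.1 x.2) : PrimrecPred fun a => ∃ b ∈ f a, p a b :=
  have hp' : PrimrecRel fun b a => p a b := hp.comp (Primrec.snd.pair Primrec.fst)
  hp'.exists_mem_list.comp hf Primrec.id

theorem primrecPred_mem {f : α → β} {g : α → List β} (hf : Primrec f) (hg : Primrec g) :
    PrimrecPred fun a => f a ∈ g a := by
  classical
  exact (primrecPred_exists_mem (p := fun a b => f a = b) hg
    (Primrec.eq.comp (hf.comp Primrec.fst) Primrec.snd)).of_eq fun a => by simp

theorem primrec_filter {p : α → β → Prop} [∀ a, DecidablePred (p a)] {f : α → List β}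
    (hf : Primrec f) (hp : PrimrecPred fun x : α × β => p x.1 x.2) :
    Primrec fun a => (f a).filter fun b => p a b := by
  have hp' : PrimrecRel fun b a => p a b := hp.comp (Primrec.snd.pair Primrec.fst)
  let _ : DecidableRel fun b a => p a b := fun b a => inferInstanceAs (Decidable (p a b))
  exact hp'.listFilter.comp hf Primrec.id

theorem primrec_product {f : α → List β} {g : α → List γ} (hf : Primrec f) (hg : Primrec g) :
    Primrec fun a => f a ×ˢ g a :=
  Primrec.list_flatMap hf (Primrec.list_map (hg.comp Primrec.fst)
    ((Primrec.snd.comp Primrec.fst).pair Primrec.snd).to₂).to₂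

theorem primrec_singleton {f : α → β} (hf : Primrec f) : Primrec fun a => [f a] :=
  Primrec.list_cons.comp hf (Primrec.const [])

theorem primrec_ite_nil {p : α → Prop} [DecidablePred p] {f : α → List β} (hp : PrimrecPred p)
    (hf : Primrec f) : Primrec fun a => if p a then f a else [] :=
  Primrec.ite hp hf (Primrec.const [])

theorem rePred_exists {δ : Type*} [Denumerable δ] {p : α → δ → Prop}
    (hp : ComputablePred fun x : α × δ => p x.1 x.2) : REPred fun a => ∃ b, p a b := by
  classical
  have hsearch : Partrec fun a => Nat.rfind
      ((fun m => decide (p a (Denumerable.ofNat δ m)) : ℕ → Bool) : ℕ →. Bool) :=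
    Partrec.rfind (hp.decide.comp
      (Computable.fst.pair ((Computable.ofNat δ).comp Computable.snd))).to₂.partrec₂
  refine hsearch.dom_re.of_eq fun a => ?_
  simp only [Nat.rfind_dom, PFun.coe_val, Part.mem_some_iff, Part.some_dom, true_eq_decide_iff,
    implies_true, and_true]
  exact (Denumerable.eqv δ).symm.surjective.exists.symm

end Computability

section Primrec

variable {α : Type*} [Primcodable α] {a : α → ARACode} {N : α → ℕ} {c c' : α → CodedConfig}

namespace CodedConfig

theorem primrec_threads (hc : Primrec c) : Primrec fun x => (c x).2.2.2 :=
  Primrec.snd.comp (Primrec.snd.comp (Primrec.snd.comp hc))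

theorem primrec_datum (hc : Primrec c) : Primrec fun x => (c x).2.2.1 :=
  Primrec.fst.comp (Primrec.snd.comp (Primrec.snd.comp hc))

theorem primrec_letter (hc : Primrec c) : Primrec fun x => (c x).2.1 :=
  Primrec.fst.comp (Primrec.snd.comp hc)

theorem primrec_data (hc : Primrec c) : Primrec fun x => (c x).data :=
  Primrec.list_cons.comp (primrec_datum hc)
    (Primrec.list_map (primrec_threads hc) (Primrec.snd.comp Primrec.snd).to₂)

theorem primrecPred_incl (hc : Primrec c) (hc' : Primrec c') :
    PrimrecPred fun x => (c x).Incl (c' x) :=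
  (Primrec.eq.comp (Primrec.fst.comp hc) (Primrec.fst.comp hc')).and <|
  (Primrec.eq.comp (primrec_letter hc) (primrec_letter hc')).and <|
  (Primrec.eq.comp (primrec_datum hc) (primrec_datum hc')).and <|
  primrecPred_forall_mem (p := fun x s => s ∈ (c' x).2.2.2) (primrec_threads hc)
    (primrecPred_mem Primrec.snd (primrec_threads (hc'.comp Primrec.fst)))

end CodedConfig

namespace ARACode

open CodedConfig

theorem primrec_instr {q : α → ℕ} (ha : Primrec a) (hq : Primrec q) :
    Primrec fun x => (a x).instr (q x) :=
  (Primrec.list_getD (0, 0, 0)).comp (Primrec.snd.comp (Primrec.snd.comp ha)) hq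

theorem primrecPred_tag_instr_eq {q : α → ℕ} (ha : Primrec a) (hq : Primrec q) (i : ℕ) :
    PrimrecPred fun x => ((a x).instr (q x)).1 = i :=
  Primrec.eq.comp (Primrec.fst.comp (primrec_instr ha hq)) (Primrec.const i)

theorem primrec_replacements {r : α → List (ℕ × ℕ)} {φ : α → ℕ × ℕ × ℕ} {e : α → ℕ}
    (ha : Primrec a) (hN : Primrec N) (hc : Primrec c) (hr : Primrec r) (hφ : Primrec φ)
    (he : Primrec e) :
    Primrec fun x => (a x).replacements (N x) (c x) (r x) (φ x) (e x) := by
  have h₁ : Primrec fun x => (φ x).2.1 := Primrec.fst.comp (Primrec.snd.comp hφ)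
  have h₂ : Primrec fun x => (φ x).2.2 := Primrec.snd.comp (Primrec.snd.comp hφ)
  have hletter := Primrec.eq.comp h₁ (primrec_letter hc)
  have htype := Primrec.eq.comp h₁ (Primrec.fst.comp hc)
  have hdatum := Primrec.eq.comp (primrec_datum hc) he
  have hguess : Primrec fun x => (List.range (N x)).map fun d => [((φ x).2.1, d)] :=
    Primrec.list_map (Primrec.list_range.comp hN)
      (primrec_singleton ((h₁.comp Primrec.fst).pair Primrec.snd)).to₂
  have hspread : PrimrecPred fun x =>
      ∀ s ∈ r x, ((a x).instr s.1).1 = 10 ∨ ((a x).instr s.1).1 = 8 :=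
    have hs : Primrec fun y : α × ℕ × ℕ => y.2.1 := Primrec.fst.comp Primrec.snd
    primrecPred_forall_mem hr ((primrecPred_tag_instr_eq (ha.comp Primrec.fst) hs 10).or
      (primrecPred_tag_instr_eq (ha.comp Primrec.fst) hs 8))
  have hcopies : Primrec fun x =>
      ((r x).filter fun s => s.1 = (φ x).2.1).map fun s => ((φ x).2.2, s.2) :=
    Primrec.list_map (primrec_filter hr (p := fun x s => s.1 = (φ x).2.1)
      (Primrec.eq.comp (Primrec.fst.comp Primrec.snd) (h₁.comp Primrec.fst)))
      ((h₂.comp Primrec.fst).pair (Primrec.snd.comp Primrec.snd)).to₂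
  refine (Primrec.list_getD []).comp ?_ (Primrec.fst.comp hφ)
  exact Primrec.list_cons.comp (primrec_ite_nil hletter (Primrec.const _)) <|
    Primrec.list_cons.comp (primrec_ite_nil hletter.not (Primrec.const _)) <|
    Primrec.list_cons.comp (primrec_ite_nil htype (Primrec.const _)) <|
    Primrec.list_cons.comp (primrec_singleton (primrec_singleton (h₁.pair (primrec_datum hc)))) <|
    Primrec.list_cons.comp (primrec_ite_nil hdatum (Primrec.const _)) <|
    Primrec.list_cons.comp (primrec_ite_nil hdatum.not (Primrec.const _)) <|
    Primrec.list_cons.comp (primrec_singleton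
      (Primrec.list_cons.comp (h₁.pair he) (primrec_singleton (h₂.pair he)))) <|
    Primrec.list_cons.comp (Primrec.list_cons.comp (primrec_singleton (h₁.pair he))
      (primrec_singleton (primrec_singleton (h₂.pair he)))) <|
    Primrec.list_cons.comp (Primrec.const _) <|
    Primrec.list_cons.comp hguess <|
    primrec_singleton (primrec_ite_nil hspread (primrec_singleton hcopies))

theorem primrec_epsSuccessors (ha : Primrec a) (hN : Primrec N) (hc : Primrec c) :
    Primrec fun x => (a x).epsSuccessors (N x) (c x) := by
  have hc₁ : Primrec fun y : α × ℕ × ℕ => c y.1 := hc.comp Primrec.fst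
  have hothers : Primrec fun y : α × ℕ × ℕ => (c y.1).2.2.2.filter fun s => s ≠ y.2 :=
    primrec_filter (p := fun y s => s ≠ y.2) (primrec_threads hc₁)
      (Primrec.eq.comp Primrec.snd (Primrec.snd.comp Primrec.fst)).not
  have hc₂ : Primrec fun y : (α × ℕ × ℕ) × List (ℕ × ℕ) => c y.1.1 := hc₁.comp Primrec.fst
  exact Primrec.list_flatMap (primrec_threads hc) (Primrec.list_map
    (primrec_replacements (ha.comp Primrec.fst) (hN.comp Primrec.fst) hc₁ hothers
      (primrec_instr (ha.comp Primrec.fst) (Primrec.fst.comp Primrec.snd))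
      (Primrec.snd.comp Primrec.snd))
    ((Primrec.fst.comp hc₂).pair ((primrec_letter hc₂).pair ((primrec_datum hc₂).pair
      (Primrec.list_append.comp Primrec.snd (hothers.comp Primrec.fst))))).to₂).to₂

theorem primrec_moveSuccessors (ha : Primrec a) (hN : Primrec N) (hc : Primrec c) :
    Primrec fun x => (a x).moveSuccessors (N x) (c x) := by
  have ha₁ : Primrec fun y : α × ℕ × ℕ => a y.1 := ha.comp Primrec.fst
  have hs : Primrec fun y : α × ℕ × ℕ => y.2.1 := Primrec.fst.comp Primrec.snd
  refine primrec_ite_nil ((Primrec.eq.comp (Primrec.fst.comp hc) (Primrec.const 0)).and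
    (primrecPred_forall_mem (primrec_threads hc) (primrecPred_tag_instr_eq ha₁ hs 8))) ?_
  exact primrec_product (Primrec.const _) <|
    primrec_product (Primrec.list_range.comp (Primrec.fst.comp ha)) <|
    primrec_product (Primrec.list_range.comp hN) <|
    primrec_singleton (Primrec.list_map (primrec_threads hc)
      ((Primrec.fst.comp (Primrec.snd.comp (primrec_instr ha₁ hs))).pair
        (Primrec.snd.comp Primrec.snd)).to₂)

theorem primrec_successors (ha : Primrec a) (hN : Primrec N) (hc : Primrec c) :
    Primrec fun x => (a x).successors (N x) (c x) :=
  Primrec.list_append.comp (primrec_epsSuccessors ha hN hc) (primrec_moveSuccessors ha hN hc)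

theorem primrec_initials (ha : Primrec a) (hN : Primrec N) :
    Primrec fun x => (a x).initials (N x) := by
  have hdatum : Primrec fun y : α × ℕ × ℕ × ℕ => y.2.2.2 :=
    Primrec.snd.comp (Primrec.snd.comp Primrec.snd)
  exact Primrec.list_map (primrec_product (Primrec.const _) <|
    primrec_product (Primrec.list_range.comp (Primrec.fst.comp ha)) (Primrec.list_range.comp hN))
    ((Primrec.fst.comp Primrec.snd).pair <|
      (Primrec.fst.comp (Primrec.snd.comp Primrec.snd)).pair <| hdatum.pair <|
      primrec_singleton ((Primrec.fst.comp (Primrec.snd.comp (ha.comp Primrec.fst))).pair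
        hdatum)).to₂

theorem primrecPred_isEmptinessCertificate {B : α → List CodedConfig} (ha : Primrec a)
    (hN : Primrec N) (hB : Primrec B) :
    PrimrecPred fun x => (a x).IsEmptinessCertificate (N x) (B x) := by
  have hincl {β : Type _} [Primcodable β] {B : β → List CodedConfig} {c : β → CodedConfig}
      (hB : Primrec B) (hc : Primrec c) : PrimrecPred fun y => ∃ b ∈ B y, b.Incl (c y) :=
    primrecPred_exists_mem (p := fun y b => b.Incl (c y)) hB
      (primrecPred_incl Primrec.snd (hc.comp Primrec.fst))
  have hbound {β : Type _} [Primcodable β] {N : β → ℕ} {c : β → CodedConfig} (hN : Primrec N)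
      (hc : Primrec c) : PrimrecPred fun y => ∀ e ∈ (c y).data, e < N y :=
    primrecPred_forall_mem (p := fun y e => e < N y) (primrec_data hc)
      (Primrec.nat_lt.comp Primrec.snd (hN.comp Primrec.fst))
  refine (primrecPred_forall_mem (primrec_initials ha (Primrec.const 1))
    (hincl (hB.comp Primrec.fst) Primrec.snd)).and (primrecPred_forall_mem hB ?_)
  have hN₁ : Primrec fun y : α × CodedConfig => N y.1 := hN.comp Primrec.fst
  refine (Primrec.eq.comp (primrec_threads Primrec.snd) (Primrec.const [])).not.and <|
    (hbound hN₁ Primrec.snd).and <| PrimrecPred.and ?_ ?_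
  · exact (primrecPred_exists_mem (p := fun y e => e ∉ y.2.data) (Primrec.list_range.comp hN₁)
      (primrecPred_mem Primrec.snd (primrec_data (Primrec.snd.comp Primrec.fst))).not).of_eq
      fun y => by simp only [List.mem_range]
  · refine primrecPred_forall_mem
      (primrec_successors (ha.comp Primrec.fst) hN₁ Primrec.snd) ?_
    exact ((hbound (hN₁.comp Primrec.fst) Primrec.snd).not.or
      (hincl (hB.comp (Primrec.fst.comp Primrec.fst)) Primrec.snd)).of_eq
      fun y => imp_iff_not_or.symm

theorem primrec_reached (ha : Primrec a) (hN : Primrec N) :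
    Primrec fun x => (a x).reached (N x) := by
  have hstep : Primrec₂ fun (b : ARACode) (y : ℕ × List CodedConfig) =>
      b.initials (y.1 + 1) ++ y.2 ++ y.2.flatMap (b.successors (y.1 + 1)) := by
    have hm : Primrec fun z : ARACode × ℕ × List CodedConfig => z.2.1 + 1 :=
      Primrec.succ.comp (Primrec.fst.comp Primrec.snd)
    have hl : Primrec fun z : ARACode × ℕ × List CodedConfig => z.2.2 :=
      Primrec.snd.comp Primrec.snd
    exact Primrec.list_append.comp (Primrec.list_append.comp (primrec_initials Primrec.fst hm) hl)
      (Primrec.list_flatMap hl (primrec_successors (Primrec.fst.comp Primrec.fst)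
        (hm.comp Primrec.fst) Primrec.snd).to₂)
  refine ((Primrec.nat_rec (Primrec.const []) hstep).comp ha hN).of_eq fun x => ?_
  induction N x with
  | zero => rfl
  | succ m ih => rw [reached, ← ih]

end ARACode

end Primrec

/-- The list of the codes of the instructions over `k` letters and `n` states. -/
def instrCodes (k n : ℕ) : List (ℕ × ℕ × ℕ) :=
  [0, 1] ×ˢ List.range k ×ˢ [0] ++ [2] ×ˢ [0, 1] ×ˢ [0] ++ [3, 8, 9] ×ˢ List.range n ×ˢ [0] ++
    [4, 5] ×ˢ [0] ×ˢ [0] ++ [6, 7, 10] ×ˢ List.range n ×ˢ List.range n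

theorem Instr.code_mem_instrCodes {A : Type v} {Q : Type w} {k n : ℕ} (eA : A ≃ Fin k)
    (eQ : Q ≃ Fin n) (φ : Instr A Q) : φ.code eA eQ ∈ instrCodes k n := by
  rcases φ with _ | _ | ⟨_ | _⟩ | _ | _ | _ | _ | _ | _ | _ | _ <;>
    simp [instrCodes, code, List.mem_product]

theorem exists_code_eq_of_mem_instrCodes {k n : ℕ} {x : ℕ × ℕ × ℕ} (hx : x ∈ instrCodes k n) :
    ∃ φ : Instr (Fin k) (Fin n), φ.code (.refl _) (.refl _) = x := by
  obtain ⟨i, y, z⟩ := x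
  simp only [instrCodes, List.mem_append, List.mem_product, List.mem_cons, List.not_mem_nil,
    or_false, List.mem_range] at hx
  rcases hx with (((⟨rfl | rfl, hy, rfl⟩ | ⟨rfl, rfl | rfl, rfl⟩) | ⟨rfl | rfl | rfl, hy, rfl⟩) |
    ⟨rfl | rfl, rfl, rfl⟩) | ⟨rfl | rfl | rfl, hy, hz⟩
  exacts [⟨.letter ⟨y, hy⟩, rfl⟩, ⟨.notLetter ⟨y, hy⟩, rfl⟩, ⟨.test .hasNext, rfl⟩,
    ⟨.test .isLast, rfl⟩, ⟨.store ⟨y, hy⟩, rfl⟩, ⟨.move ⟨y, hy⟩, rfl⟩, ⟨.guess ⟨y, hy⟩, rfl⟩,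
    ⟨.eq, rfl⟩, ⟨.neq, rfl⟩, ⟨.and ⟨y, hy⟩ ⟨z, hz⟩, rfl⟩, ⟨.or ⟨y, hy⟩ ⟨z, hz⟩, rfl⟩,
    ⟨.spread ⟨y, hy⟩ ⟨z, hz⟩, rfl⟩]

theorem primrec_instrCodes {α : Type*} [Primcodable α] {k n : α → ℕ} (hk : Primrec k)
    (hn : Primrec n) : Primrec fun x => instrCodes (k x) (n x) := by
  have hconst (l : List ℕ) : Primrec fun _ : α => l := Primrec.const l
  have hletters : Primrec fun x => List.range (k x) := Primrec.list_range.comp hk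
  have hstates : Primrec fun x => List.range (n x) := Primrec.list_range.comp hn
  have happend {f g : α → List (ℕ × ℕ × ℕ)} (hf : Primrec f) (hg : Primrec g) :
      Primrec fun x => f x ++ g x := Primrec.list_append.comp hf hg
  have hblock {f g : α → List ℕ} (l : List ℕ) (hf : Primrec f) (hg : Primrec g) :
      Primrec fun x => l ×ˢ f x ×ˢ g x := primrec_product (hconst l) (primrec_product hf hg)
  exact happend (happend (happend (happend (hblock _ hletters (hconst _))
    (hblock _ (hconst _) (hconst _))) (hblock _ hstates (hconst _)))
    (hblock _ (hconst _) (hconst _))) (hblock _ hstates hstates)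

namespace ARACode

/-- `a` is `M.code eA eQ` for some automaton `M` and numberings `eA` and `eQ`. -/
def IsValid (a : ARACode) : Prop :=
  a.2.1 < a.2.2.length ∧ ∀ x ∈ a.2.2, x ∈ instrCodes a.1 a.2.2.length

theorem isValid_code {A : Type v} {Q : Type w} {k n : ℕ} (M : ARA A Q) (eA : A ≃ Fin k)
    (eQ : Q ≃ Fin n) : IsValid (M.code eA eQ) := by
  refine ⟨by simp [ARA.code], fun x hx => ?_⟩
  obtain ⟨j, rfl⟩ := (List.mem_ofFn' _ _).1 hx
  simpa [ARA.code] using (M.δ (eQ.symm j)).code_mem_instrCodes eA eQ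

theorem IsValid.exists_code_eq {a : ARACode} (h : a.IsValid) :
    ∃ M : ARA (Fin a.1) (Fin a.2.2.length), M.code (.refl _) (.refl _) = a := by
  have hδ (j : Fin a.2.2.length) := exists_code_eq_of_mem_instrCodes (h.2 _ (a.2.2.get_mem j))
  choose δ hδ using hδ
  refine ⟨⟨⟨a.2.1, h.1⟩, δ⟩, ?_⟩
  simp [ARA.code, hδ]

theorem primrecPred_isValid : PrimrecPred IsValid := by
  have htable : Primrec fun a : ARACode => a.2.2 := Primrec.snd.comp Primrec.snd
  have hlength : Primrec fun a : ARACode => a.2.2.length := Primrec.list_length.comp htable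
  have hinitial : PrimrecPred fun a : ARACode => a.2.1 < a.2.2.length :=
    Primrec.nat_lt.comp (Primrec.fst.comp Primrec.snd) hlength
  have hcodes : Primrec fun x : ARACode × ℕ × ℕ × ℕ => instrCodes x.1.1 x.1.2.2.length :=
    primrec_instrCodes (Primrec.fst.comp Primrec.fst) (hlength.comp Primrec.fst)
  have hinstr : PrimrecPred fun a : ARACode => ∀ x ∈ a.2.2, x ∈ instrCodes a.1 a.2.2.length :=
    primrecPred_forall_mem htable (primrecPred_mem Primrec.snd hcodes)
  exact hinitial.and hinstr

/-- The decision procedure for emptiness: the valid codes with a certificate of emptiness. -/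
def HasEmptyLanguage (a : ARACode) : Prop :=
  a.IsValid ∧ ∃ N B, a.IsEmptinessCertificate N B

theorem hasEmptyLanguage_code_iff {A : Type v} {Q : Type w} [DecidableEq Q] {k n : ℕ}
    (M : ARA A Q) (eA : A ≃ Fin k) (eQ : Q ≃ Fin n) :
    HasEmptyLanguage (M.code eA eQ) ↔ M.language ℕ = ∅ := by
  rw [HasEmptyLanguage, exists_isEmptinessCertificate_iff]
  exact and_iff_right (isValid_code M eA eQ)

theorem not_hasEmptyLanguage_iff {a : ARACode} :
    ¬ a.HasEmptyLanguage ↔ ∃ m, ¬ a.IsValid ∨ ∃ c ∈ a.reached m, c.2.2.2 = [] := by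
  by_cases ha : a.IsValid
  · obtain ⟨M, hM⟩ := ha.exists_code_eq
    have hempty := hasEmptyLanguage_code_iff M (.refl _) (.refl _)
    have hreached := exists_mem_reached_iff M (.refl _) (.refl _)
    rw [hM] at hempty hreached
    simp only [hempty, ha, not_true_eq_false, false_or, hreached]
  · simp [HasEmptyLanguage, ha]

theorem computablePred_hasEmptyLanguage : ComputablePred HasEmptyLanguage := by
  refine ComputablePred.computable_iff_re_compl_re'.2 ⟨?_, ?_⟩
  · refine (rePred_exists (p := fun (a : ARACode) (x : ℕ × List CodedConfig) =>
      a.IsValid ∧ a.IsEmptinessCertificate x.1 x.2) (PrimrecPred.computablePred ?_)).of_eq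
        fun a => by simp only [HasEmptyLanguage, Prod.exists, exists_and_left]
    exact (primrecPred_isValid.comp Primrec.fst).and (primrecPred_isEmptinessCertificate
      Primrec.fst (Primrec.fst.comp Primrec.snd) (Primrec.snd.comp Primrec.snd))
  · refine (rePred_exists (p := fun (a : ARACode) m => ¬ a.IsValid ∨
      ∃ c ∈ a.reached m, c.2.2.2 = []) (PrimrecPred.computablePred ?_)).of_eq
        fun a => not_hasEmptyLanguage_iff.symm
    exact (primrecPred_isValid.comp Primrec.fst).not.or
      (primrecPred_exists_mem (p := fun _ c => c.2.2.2 = [])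
        (primrec_reached Primrec.fst Primrec.snd)
        (Primrec.eq.comp (CodedConfig.primrec_threads Primrec.snd) (Primrec.const [])))

end ARACode

theorem mainTheorem3 (D : Type u) [DecidableEq D] [Infinite D] :
    (∃ P : ℕ × ℕ × List (ℕ × ℕ × ℕ) → Prop, ComputablePred P ∧
      ∀ (A : Type v) (Q : Type w) [DecidableEq Q] (k n : ℕ) (eA : A ≃ Fin k) (eQ : Q ≃ Fin n)
        (M : ARA A Q), P (M.code eA eQ) ↔ M.language D = ∅) ∧
    ∀ (A : Type v) (Q : Type w) [Finite A] [Finite Q] [DecidableEq Q] (M : ARA A Q),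
      IsWQO (Config.Below (A := A) (Q := Q) (D := D)) ∧
      IsRDC (M.Step (D := D)) Config.Below ∧
      IsDownwardClosed Config.Below {C : Config A Q D | C.Accepting} := by
  refine ⟨⟨ARACode.HasEmptyLanguage, ARACode.computablePred_hasEmptyLanguage,
    fun A Q _ k n eA eQ M => ?_⟩, fun A Q _ _ _ M =>
    ⟨Config.isWQO_below, M.isRDC_step, fun C C' hC' hC => hC.accepting hC'⟩⟩
  rw [ARACode.hasEmptyLanguage_code_iff]
  exact ⟨ARA.language_eq_empty_of_infinite, ARA.language_eq_empty_of_infinite⟩
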